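/- Let $R\ge 2$ be an integer, let $B\subset\mathbb Z$ be a finite non-empty set with $N=|B|$, and let $\mu=\mu(R,B)$ be the unique Borel probability measure on $\mathbb R$ with $\mu(E)=\frac1N\sum_{b\in B}\mu(\tau_b^{-1}(E))$ for all Borel sets $E$, where $\tau_b(x)=R^{-1}(x+b)$. Let $L\subset\mathbb Z$ be a finite set with $0\in L$ and let $(\alpha_l)_{l\in L}$ be complex numbers such that $\alpha_0=1$ and the matrix $$T=\frac1{\sqrt N}\left(e^{2\pi i R^{-1}lb}\,\alpha_l\right)_{l\in L,\,b\in B}$$ is an isometry, i.e. its columns are orthonormal: $\frac1N\sum_{l\in L}|\alpha_l|^2e^{2\pi iR^{-1}l(b-b')}=\delta_{b,b'}$ for all $b,b'\in B$. Put $e_\lambda(x)=e^{2\pi i\lambda x}$, $m_B(x)=\frac1N\sum_{b\in B}e^{2\pi i bx}$ and $g_l(t)=R^{-1}(t-l)$ for $\lambda,x,t\in\mathbb R$, $l\in L$. The transition from $t$ to $g_l(t)$ (with digit $l$) is called possible if $\alpha_l\,m_B(g_l(t))\neq0$. A set $\mathcal M\subset\mathbb R$ is invariant if $g_l(t)\in\mathcal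 M$ whenever $t\in\mathcal M$, $l\in L$ and the transition from $t$ to $g_l(t)$ is possible. A min-set is a finite set that is minimal (for inclusion) among the non-empty invariant sets. For every min-set $\mathcal M$ choose a point $c(\mathcal M)\in\mathcal M$. For a point $c$ of a min-set, a word $l_0\dots l_{p-1}$ with digits in $L$, $p\ge1$, is a cycle word for $c$ if $g_{l_{p-1}}\cdots g_{l_0}(c)=c$, $g_{l_k}\cdots g_{l_0}(c)\ne c$ for $0\le k<p-1$, and all the transitions $c\to g_{l_0}(c)\to g_{l_1}g_{l_0}(c)\to\dots\to g_{l_{p-1}}\cdots g_{l_0}(c)=c$, with digits $l_0,l_1,\dots,l_{p-1}$ in this order, are possible. Let $\Omega(c)$ be the set of all finite words with digits in $L$, including the empty word, that are not of the form $\omega\omega_0$ with $\omega$ an arbitrary (possibly empty) word and $\omega_0$ a cycle word for $c$. Then, for every choice of the points $c(\mathcal M)$, the family $$\left(\prod_{j=0}^{k}\alpha_{l_j}\right)e_{\,l_0+Rl_1+\dots+R^kl_k+R^{k+1}c(\mathcal M)},$$ indexed by all pairs $(\mathcal M,\,l_0\dots l_k)$ with $\mathcal M$ a min-set and $l_0\dots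 l_k\in\Omega(c(\mathcal M))$ (the empty word contributes $e_{c(\mathcal M)}$), is a Parseval frame for $L^2(\mu)$: for every $v\in L^2(\mu)$, the sum of $|\langle v,f\rangle|^2$ over the members $f$ of the family, counted with multiplicity, equals $\|v\|^2$. -/

import Mathlib

open MeasureTheory ProbabilityTheory

noncomputable section

namespace WeightedFourier

/-! ### The self-affine measure -/

/-- The maps `τ_b(x) = R⁻¹ (x + b)` of the iterated function system. -/
def tau (R : ℕ) (b : ℤ) (x : ℝ) : ℝ := (R : ℝ)⁻¹ * (x + (b : ℝ))

/-- `μ` is invariant for the iterated function system `(τ_b)_{b ∈ B}` with equal weights: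
`μ(E) = (1/N) ∑_{b ∈ B} μ(τ_b⁻¹ E)` for all Borel sets `E`. -/
def IsSelfAffine (R : ℕ) (B : Finset ℤ) (μ : Measure ℝ) : Prop :=
  ∀ E : Set ℝ, MeasurableSet E →
    μ E = (B.card : ENNReal)⁻¹ * ∑ b ∈ B, μ (tau R b ⁻¹' E)

/-- The uniform probability measure on the digit set `B`. -/
def digitMeasure (B : Finset ℤ) (hB : B.Nonempty) : Measure B :=
  haveI : Nonempty B := hB.to_subtype
  (PMF.uniformOfFintype B).toMeasure

instance (B : Finset ℤ) (hB : B.Nonempty) : IsProbabilityMeasure (digitMeasure B hB) := by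
  have : Nonempty B := hB.to_subtype
  unfold digitMeasure
  infer_instance

/-- The point `∑_{k ≥ 1} R^{-k} b_k` of the attractor with digits `b_1, b_2, …` in `B`. -/
def codingMap (R : ℕ) (B : Finset ℤ) (ω : ℕ → B) : ℝ :=
  ∑' k : ℕ, ((R : ℝ)⁻¹) ^ (k + 1) * (((ω k : B) : ℤ) : ℝ)

/-- The self-affine measure `μ(R, B)`, realized as the law of `∑_{k ≥ 1} R^{-k} b_k` with
independent digits `b_k` distributed uniformly on `B`. By `isSelfAffine_selfAffineMeasure` and
`eq_selfAffineMeasure` below, for `R ≥ 2` it is the unique Borel probability measure on `ℝ` that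
satisfies `IsSelfAffine R B`. -/
def selfAffineMeasure (R : ℕ) (B : Finset ℤ) (hB : B.Nonempty) : Measure ℝ :=
  (Measure.infinitePi (fun _ : ℕ => digitMeasure B hB)).map (codingMap R B)

theorem inv_natCast_lt_one {R : ℕ} (hR : 2 ≤ R) : (R : ℝ)⁻¹ < 1 :=
  inv_lt_one_of_one_lt₀ (by exact_mod_cast hR)

theorem exists_abs_digit_le (B : Finset ℤ) : ∃ K : ℝ, ∀ b : B, |((b : ℤ) : ℝ)| ≤ K :=
  ⟨∑ b ∈ B, |(b : ℝ)|, fun b =>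
    Finset.single_le_sum (f := fun b : ℤ => |(b : ℝ)|) (fun _ _ => abs_nonneg _) b.2⟩

theorem summable_coding {R : ℕ} (hR : 2 ≤ R) (B : Finset ℤ) (ω : ℕ → B) :
    Summable fun k : ℕ => ((R : ℝ)⁻¹) ^ (k + 1) * (((ω k : B) : ℤ) : ℝ) := by
  obtain ⟨K, hK⟩ := exists_abs_digit_le B
  have hs : Summable fun k : ℕ => ((R : ℝ)⁻¹) ^ (k + 1) * K :=
    ((summable_nat_add_iff 1).2
      (summable_geometric_of_lt_one (by positivity) (inv_natCast_lt_one hR))).mul_right K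
  refine Summable.of_norm_bounded hs fun k => ?_
  rw [norm_mul, Real.norm_of_nonneg (by positivity), Real.norm_eq_abs]
  exact mul_le_mul_of_nonneg_left (hK _) (by positivity)

theorem measurable_codingMap (R : ℕ) (B : Finset ℤ) :
    Measurable (codingMap R B) := by
  unfold codingMap
  fun_prop

instance isProbabilityMeasure_selfAffineMeasure (R : ℕ) (B : Finset ℤ) (hB : B.Nonempty) :
    IsProbabilityMeasure (selfAffineMeasure R B hB) :=
  Measure.isProbabilityMeasure_map (measurable_codingMap R B).aemeasurable

/-- Put a digit in front of a sequence of digits. -/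
def consDigit (B : Finset ℤ) (p : B × (ℕ → B)) : ℕ → B := fun n => Nat.casesOn n p.1 p.2

theorem measurable_consDigit (B : Finset ℤ) : Measurable (consDigit B) := by
  refine measurable_pi_lambda _ fun n => ?_
  cases n with
  | zero => exact measurable_fst
  | succ n => exact (measurable_pi_apply n).comp measurable_snd

theorem map_consDigit (B : Finset ℤ) (hB : B.Nonempty) :
    ((digitMeasure B hB).prod (Measure.infinitePi fun _ : ℕ => digitMeasure B hB)).map
      (consDigit B) = Measure.infinitePi fun _ : ℕ => digitMeasure B hB := by
  classical
  refine Measure.eq_infinitePi _ fun s t ht => ?_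
  obtain ⟨n, hn⟩ : ∃ n, s ⊆ Finset.range (n + 1) :=
    ⟨s.sup id, fun i hi => Finset.mem_range_succ_iff.2 (Finset.le_sup (f := id) hi)⟩
  set u : ℕ → Set B := fun i => if i ∈ s then t i else Set.univ with hu
  have hum : ∀ i, MeasurableSet (u i) := fun i => by
    by_cases hi : i ∈ s <;> simp [hu, hi, ht]
  have h1 : Set.pi (s : Set ℕ) t = Set.pi (Finset.range (n + 1) : Set ℕ) u := by
    ext x
    simp only [Set.mem_pi, Finset.mem_coe, hu]
    constructor
    · intro h i _
      by_cases his : i ∈ s <;> simp [his, h]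
    · intro h i hi
      simpa [hi] using h i (hn hi)
  have h2 : ∏ i ∈ s, digitMeasure B hB (t i)
      = ∏ i ∈ Finset.range (n + 1), digitMeasure B hB (u i) := by
    rw [← Finset.prod_subset hn]
    · exact Finset.prod_congr rfl fun i hi => by simp [hu, hi]
    · intro i _ hi
      simp [hu, hi]
  have h3 : consDigit B ⁻¹' Set.pi (Finset.range (n + 1) : Set ℕ) u
      = u 0 ×ˢ Set.pi (Finset.range n : Set ℕ) (fun i => u (i + 1)) := by
    ext p
    simp only [Set.mem_preimage, Set.mem_pi, Finset.mem_coe, Finset.mem_range, Set.mem_prod]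
    constructor
    · intro h
      exact ⟨h 0 (by omega), fun i hi => h (i + 1) (by omega)⟩
    · rintro ⟨h0, h⟩ i hi
      cases i with
      | zero => exact h0
      | succ i => exact h i (by omega)
  rw [h1, h2, Measure.map_apply (measurable_consDigit B)
    (MeasurableSet.pi (Finset.countable_toSet _) fun i _ => hum i), h3, Measure.prod_prod,
    Measure.infinitePi_pi _ (fun i _ => hum (i + 1)), Finset.prod_range_succ', mul_comm]

theorem codingMap_consDigit {R : ℕ} (hR : 2 ≤ R) (B : Finset ℤ) (p : B × (ℕ → B)) :
    codingMap R B (consDigit B p) = tau R p.1 (codingMap R B p.2) := by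
  unfold codingMap tau
  rw [(summable_coding hR B (consDigit B p)).tsum_eq_zero_add, mul_add, ← tsum_mul_left, add_comm]
  simp only [consDigit, zero_add, pow_one]
  congr 1
  refine tsum_congr fun k => ?_
  ring

/-- The measure `μ(R, B)` is invariant for the iterated function system. -/
theorem isSelfAffine_selfAffineMeasure {R : ℕ} (hR : 2 ≤ R) (B : Finset ℤ) (hB : B.Nonempty) :
    IsSelfAffine R B (selfAffineMeasure R B hB) := by
  intro E hE
  have htau : ∀ b : ℤ, Measurable (tau R b) := fun b => by unfold tau; fun_prop
  have hX := measurable_codingMap R B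
  have hm : MeasurableSet (codingMap R B ∘ consDigit B ⁻¹' E) :=
    (hX.comp (measurable_consDigit B)) hE
  have : Nonempty B := hB.to_subtype
  have hd : ∀ b : B, digitMeasure B hB {b} = (B.card : ENNReal)⁻¹ := fun b => by
    unfold digitMeasure
    rw [PMF.toMeasure_apply_singleton _ _ (measurableSet_singleton b)]
    simp
  have key : selfAffineMeasure R B hB E = ∫⁻ b, selfAffineMeasure R B hB (tau R (b : ℤ) ⁻¹' E)
      ∂(digitMeasure B hB) := by
    conv_lhs => rw [selfAffineMeasure, ← map_consDigit B hB,
      Measure.map_map hX (measurable_consDigit B),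
      Measure.map_apply (hX.comp (measurable_consDigit B)) hE, Measure.prod_apply hm]
    refine lintegral_congr fun b => ?_
    rw [selfAffineMeasure, Measure.map_apply hX (htau b hE)]
    congr 1
    ext ω
    simp [codingMap_consDigit hR]
  rw [key, lintegral_fintype]
  simp only [hd]
  rw [← Finset.sum_mul, mul_comm]
  congr 1
  exact Finset.sum_coe_sort B fun b => selfAffineMeasure R B hB (tau R b ⁻¹' E)

theorem charFun_of_isSelfAffine {R : ℕ} {B : Finset ℤ} {μ : Measure ℝ} [IsProbabilityMeasure μ]
    (h : IsSelfAffine R B μ) (t : ℝ) :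
    charFun μ t = (B.card : ℂ)⁻¹ * (∑ b ∈ B, Complex.exp (t * (R : ℝ)⁻¹ * b * Complex.I)) *
      charFun μ ((R : ℝ)⁻¹ * t) := by
  have htau : ∀ b : ℤ, Measurable (tau R b) := fun b => by unfold tau; fun_prop
  have hμ : μ = ((B.card : ENNReal)⁻¹) • ∑ b ∈ B, μ.map (tau R b) := by
    ext E hE
    rw [h E hE, Measure.smul_apply, Measure.finsetSum_apply, smul_eq_mul]
    congr 1
    exact Finset.sum_congr rfl fun b _ => (Measure.map_apply (htau b) hE).symm
  have hb : ∀ b : ℤ, charFun (μ.map (tau R b)) t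
      = Complex.exp (t * (R : ℝ)⁻¹ * b * Complex.I) * charFun μ ((R : ℝ)⁻¹ * t) := by
    intro b
    rw [charFun_apply_real, charFun_apply_real, integral_map (htau b).aemeasurable
      (by fun_prop), ← integral_const_mul]
    refine integral_congr_ae (Filter.Eventually.of_forall fun x => ?_)
    simp only [tau]
    rw [← Complex.exp_add]
    push_cast
    ring_nf
  have hint : ∀ b ∈ B, Integrable (fun x : ℝ => Complex.exp (t * x * Complex.I))
      (μ.map (tau R b)) := by
    intro b _
    have : IsProbabilityMeasure (μ.map (tau R b)) :=
      Measure.isProbabilityMeasure_map (htau b).aemeasurable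
    refine Integrable.of_bound (C := 1) (by fun_prop) (Filter.Eventually.of_forall fun x => ?_)
    rw [← Complex.ofReal_mul, Complex.norm_exp_ofReal_mul_I]
  conv_lhs => rw [hμ]
  rw [charFun_apply_real, integral_smul_measure, integral_finsetSum_measure hint, mul_assoc,
    Finset.sum_mul]
  simp only [← charFun_apply_real, hb]
  simp

/-- The measure `μ(R, B)` is the only probability measure that is invariant for the iterated
function system. -/
theorem eq_selfAffineMeasure {R : ℕ} (hR : 2 ≤ R) (B : Finset ℤ) (hB : B.Nonempty)
    (μ : Measure ℝ) [IsProbabilityMeasure μ] (h : IsSelfAffine R B μ) :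
    μ = selfAffineMeasure R B hB := by
  have h' := isSelfAffine_selfAffineMeasure hR B hB
  set ν := selfAffineMeasure R B hB
  refine Measure.ext_of_charFun (funext fun t => ?_)
  have hstep : ∀ s : ℝ, ‖charFun μ s - charFun ν s‖
      ≤ ‖charFun μ ((R : ℝ)⁻¹ * s) - charFun ν ((R : ℝ)⁻¹ * s)‖ := by
    intro s
    rw [charFun_of_isSelfAffine h s, charFun_of_isSelfAffine h' s, ← mul_sub, norm_mul]
    refine mul_le_of_le_one_left (norm_nonneg _) ?_
    rw [norm_mul, norm_inv, Complex.norm_natCast]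
    have hc : (0 : ℝ) < B.card := by exact_mod_cast hB.card_pos
    rw [inv_mul_le_one₀ hc]
    refine (norm_sum_le _ _).trans ?_
    have : ∀ b ∈ B, ‖Complex.exp (s * (R : ℝ)⁻¹ * b * Complex.I)‖ ≤ (1 : ℝ) := fun b _ => by
      have := Complex.norm_exp_ofReal_mul_I (s * (R : ℝ)⁻¹ * b)
      push_cast at this ⊢
      exact this.le
    simpa using Finset.sum_le_sum this
  have hn : ∀ n : ℕ, ‖charFun μ t - charFun ν t‖
      ≤ ‖charFun μ (((R : ℝ)⁻¹) ^ n * t) - charFun ν (((R : ℝ)⁻¹) ^ n * t)‖ := by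
    intro n
    induction n with
    | zero => simp
    | succ n ih =>
      refine ih.trans ((hstep _).trans (le_of_eq ?_))
      rw [← mul_assoc, ← pow_succ']
  have hlim : Filter.Tendsto
      (fun n : ℕ => ‖charFun μ (((R : ℝ)⁻¹) ^ n * t) - charFun ν (((R : ℝ)⁻¹) ^ n * t)‖)
      Filter.atTop (nhds 0) := by
    have h0 : Filter.Tendsto (fun n : ℕ => ((R : ℝ)⁻¹) ^ n * t) Filter.atTop (nhds 0) := by
      simpa using (tendsto_pow_atTop_nhds_zero_of_lt_one (by positivity)
        (inv_natCast_lt_one hR)).mul_const t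
    have hc : Continuous fun s : ℝ => ‖charFun μ s - charFun ν s‖ :=
      (continuous_charFun.sub continuous_charFun).norm
    have h1 := (hc.tendsto 0).comp h0
    simp only [charFun_zero, probReal_univ, sub_self, norm_zero] at h1
    exact h1
  have := ge_of_tendsto' hlim hn
  exact sub_eq_zero.1 (norm_le_zero_iff.1 this)

/-! ### Exponentials and Parseval frames -/

/-- The exponential `e_t(x) = exp(2π i t x)`. -/
def expFun (t : ℝ) (x : ℝ) : ℂ := Complex.exp (2 * Real.pi * Complex.I * t * x)

theorem memLp_expFun (μ : Measure ℝ) [IsFiniteMeasure μ] (t : ℝ) : MemLp (expFun t) 2 μ := by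
  refine MemLp.of_bound (C := 1) ?_ (Filter.Eventually.of_forall fun x => ?_)
  · unfold expFun
    fun_prop
  · have := Complex.norm_exp_ofReal_mul_I (2 * Real.pi * t * x)
    unfold expFun
    rw [← this]
    apply le_of_eq
    push_cast
    ring_nf

/-- The exponential `e_t` as an element of `L²(μ)`. -/
def expL2 (μ : Measure ℝ) [IsFiniteMeasure μ] (t : ℝ) : Lp ℂ 2 μ :=
  (memLp_expFun μ t).toLp (expFun t)

/-- The family `f` is a Parseval frame for `H`: `∑_i |⟨v, f_i⟩|² = ‖v‖²` for all `v ∈ H`. -/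
def IsParsevalFrame {ι H : Type*} [NormedAddCommGroup H] [InnerProductSpace ℂ H]
    (f : ι → H) : Prop :=
  ∀ v : H, HasSum (fun i => ‖inner ℂ v (f i)‖ ^ 2) (‖v‖ ^ 2)

/-! ### The weighted matrix, transitions and min-sets -/

/-- The matrix `T = N^{-1/2} (e^{2π i R⁻¹ l b} α_l)_{l ∈ L, b ∈ B}`, with rows indexed by `L` and
columns indexed by `B`. -/
def weightedMatrix (R : ℕ) (B L : Finset ℤ) (α : ℤ → ℂ) : Matrix L B ℂ :=
  Matrix.of fun l b => (1 / (Real.sqrt (B.card : ℝ) : ℂ)) *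
    (Complex.exp (2 * Real.pi * Complex.I * (R : ℂ)⁻¹ * ((l : ℤ) : ℂ) * ((b : ℤ) : ℂ)) *
      α (l : ℤ))

/-- The function `m_B(x) = (1/N) ∑_{b ∈ B} e^{2π i b x}`. -/
def mB (B : Finset ℤ) (x : ℝ) : ℂ :=
  (1 / (B.card : ℂ)) * ∑ b ∈ B, Complex.exp (2 * Real.pi * Complex.I * (b : ℂ) * x)

/-- The maps `g_l(t) = R⁻¹ (t - l)`. -/
def g (R : ℕ) (l : ℤ) (t : ℝ) : ℝ := (R : ℝ)⁻¹ * (t - (l : ℝ))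

/-- The transition from `t` to `g_l(t)` is possible (in one step, with digit `l`). -/
def StepPossible (R : ℕ) (B : Finset ℤ) (α : ℤ → ℂ) (l : ℤ) (t : ℝ) : Prop :=
  α l * mB B (g R l t) ≠ 0

/-- `M` is invariant: it contains the target of every possible transition from a point of `M`. -/
def IsInvariant (R : ℕ) (B L : Finset ℤ) (α : ℤ → ℂ) (M : Set ℝ) : Prop :=
  ∀ t ∈ M, ∀ l ∈ L, StepPossible R B α l t → g R l t ∈ M

/-- A min-set is a finite set that is minimal among the non-empty invariant sets. -/
def IsMinSet (R : ℕ) (B L : Finset ℤ) (α : ℤ → ℂ) (M : Set ℝ) : Prop :=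
  M.Finite ∧ Minimal (fun A : Set ℝ => A.Nonempty ∧ IsInvariant R B L α A) M

/-! ### Words -/

/-- For a word `w = l_0 l_1 … l_k`, the point `g_{l_k} ⋯ g_{l_1} g_{l_0}(t)`. -/
def wordAct (R : ℕ) {L : Finset ℤ} (w : List L) (t : ℝ) : ℝ :=
  w.foldl (fun s l => g R (l : ℤ) s) t

/-- The (non-empty) word `w = l_0 … l_{p-1}` is a cycle word for `c`: the successive transitions
from `c` with the digits of `w` are all possible, they lead back to `c` at the last step, and at no
earlier one. -/
def IsCycleWord (R : ℕ) (B : Finset ℤ) {L : Finset ℤ} (α : ℤ → ℂ) (c : ℝ) (w : List L) : Prop :=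
  w ≠ [] ∧ wordAct R w c = c ∧
    (∀ k : ℕ, 0 < k → k < w.length → wordAct R (w.take k) c ≠ c) ∧
    ∀ k : Fin w.length, StepPossible R B α ((w.get k : L) : ℤ) (wordAct R (w.take k) c)

/-- `Ω(c)`: the finite words with digits in `L` (including the empty word) that do not end in a
cycle word for `c`. -/
def Omega (R : ℕ) (B L : Finset ℤ) (α : ℤ → ℂ) (c : ℝ) : Set (List L) :=
  {w | ¬ ∃ u v : List L, w = u ++ v ∧ IsCycleWord R B α c v}

/-- The weight `∏_j α_{l_j}` of a word; it is `1` for the empty word. -/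
def wordWeight {L : Finset ℤ} (α : ℤ → ℂ) (w : List L) : ℂ :=
  ∏ j : Fin w.length, α ((w.get j : L) : ℤ)

/-- The frequency `l_0 + R l_1 + ⋯ + R^k l_k + R^{k+1} c` of a word `l_0 … l_k`; it is `c` for the
empty word. -/
def wordFreq (R : ℕ) {L : Finset ℤ} (w : List L) (c : ℝ) : ℝ :=
  (∑ j : Fin w.length, (R : ℝ) ^ (j : ℕ) * (((w.get j : L) : ℤ) : ℝ)) + (R : ℝ) ^ w.length * c

end WeightedFourier

end

/-! Consider the random walk on the real line that moves from `t` to `g_l(t)` with probability `|α_l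
m_B(g_l(t))|²`; the isometry of `T` makes these probabilities add up to 1 (`sum_norm_mB_sq`). The
possible targets from a point of a finite invariant set are congruent modulo 1, which forces `|m_B|
= 1` at them (`IsInvariant.isUnimodular_g`). Hence the points of min-sets are unimodular, and their
exponentials are orthonormal (`orthonormal_minSetUnion`).

Upper bound. The operators `branch` split `v` into pieces whose squared norms add up to that of `v`,
and they intertwine exponential coefficients at unimodular frequencies. Iterating them `n` times,
from Bessel's inequality on the min-sets, bounds the sum over all words of length `n` ending in a
min-set (`tsum_reach_mul_le`). The words of `Ω` of length at most `n` weigh no more than these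
(`tsum_hit_le_reach`), so the family satisfies Bessel's inequality.

Lower bound. Let `F(t)` be the sum of `|⟨e_t, f⟩|²` over the family. Prefixing a digit keeps a word
in `Ω(c)` unless the new word leads from `c` back to `c`; such words are paid for by the empty word,
so `F` is superharmonic for the walk (`sum_mul_coeffSum_le`). Moreover `F ≥ 1` at each chosen point,
and `F` is real-analytic because `μ` has bounded support. In the minimum principle
`one_le_of_sum_le`, the minimizers on an interval form an invariant set: if finite it contains a
min-set, if infinite `F` is constant with value `F(0)`, and `{0}` is a min-set. So `F = 1`: the
analysis operator is a contraction preserving the norm of every exponential, hence an isometry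
(`norm_eq_of_dense_span`). -/

namespace WeightedFourier

open scoped ComplexConjugate ENNReal

/-! ### Unimodular exponentials -/

/-- The character `x ↦ exp(2π i x)` of `ℝ`. -/
noncomputable def unitExp (x : ℝ) : ℂ := Complex.exp (2 * Real.pi * Complex.I * x)

theorem unitExp_add (x y : ℝ) : unitExp (x + y) = unitExp x * unitExp y := by
  unfold unitExp
  rw [← Complex.exp_add]
  push_cast
  ring_nf

@[simp]
theorem unitExp_zero : unitExp 0 = 1 := by simp [unitExp]

theorem unitExp_eq_ofReal_mul_I (x : ℝ) :
    unitExp x = Complex.exp (((2 * Real.pi * x : ℝ) : ℂ) * Complex.I) := by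
  unfold unitExp
  push_cast
  ring_nf

@[simp]
theorem norm_unitExp (x : ℝ) : ‖unitExp x‖ = 1 := by
  rw [unitExp_eq_ofReal_mul_I, Complex.norm_exp_ofReal_mul_I]

theorem conj_unitExp (x : ℝ) : conj (unitExp x) = unitExp (-x) := by
  unfold unitExp
  rw [← Complex.exp_conj]
  simp only [map_mul, Complex.conj_ofReal, Complex.conj_I, Complex.conj_ofNat]
  push_cast
  ring_nf

@[simp]
theorem unitExp_intCast (n : ℤ) : unitExp n = 1 := by
  unfold unitExp
  rw [Complex.exp_eq_one_iff]
  exact ⟨n, by push_cast; ring⟩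

theorem unitExp_natCast_mul (n : ℕ) (x : ℝ) : unitExp (n * x) = unitExp x ^ n := by
  unfold unitExp
  rw [← Complex.exp_nat_mul]
  push_cast
  ring_nf

theorem continuous_unitExp : Continuous unitExp := by
  unfold unitExp
  fun_prop

theorem expFun_eq_unitExp (t x : ℝ) : expFun t x = unitExp (t * x) := by
  unfold expFun unitExp
  push_cast
  ring_nf

theorem mB_eq_unitExp (B : Finset ℤ) (x : ℝ) :
    mB B x = (B.card : ℂ)⁻¹ * ∑ b ∈ B, unitExp (b * x) := by
  unfold mB unitExp
  rw [one_div]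
  push_cast
  congr 1
  refine Finset.sum_congr rfl fun b _ => ?_
  ring_nf

theorem card_ne_zero_complex {B : Finset ℤ} (hB : B.Nonempty) : (B.card : ℂ) ≠ 0 := by
  exact_mod_cast hB.card_pos.ne'

theorem norm_mB_le_one (B : Finset ℤ) (x : ℝ) : ‖mB B x‖ ≤ 1 := by
  rw [mB_eq_unitExp, norm_mul, norm_inv, Complex.norm_natCast]
  refine inv_mul_le_one_of_le₀ ?_ (by positivity)
  refine (norm_sum_le _ _).trans ?_
  simp

theorem mB_add_intCast (B : Finset ℤ) (x : ℝ) (n : ℤ) : mB B (x + n) = mB B x := by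
  simp only [mB_eq_unitExp]
  congr 1
  refine Finset.sum_congr rfl fun b _ => ?_
  rw [mul_add, unitExp_add]
  have : unitExp ((b : ℝ) * n) = 1 := by exact_mod_cast unitExp_intCast (b * n)
  rw [this, mul_one]

theorem mB_zero {B : Finset ℤ} (hB : B.Nonempty) : mB B 0 = 1 := by
  simp [mB_eq_unitExp, card_ne_zero_complex hB]

/-! ### Unimodular points of `mB` -/

/-- The points at which all the terms of `mB` agree. -/
def IsUnimodular (B : Finset ℤ) (s : ℝ) : Prop := ∀ b ∈ B, unitExp (b * s) = mB B s

theorem IsUnimodular.norm_eq_one {B : Finset ℤ} (hB : B.Nonempty) {s : ℝ}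
    (h : IsUnimodular B s) : ‖mB B s‖ = 1 := by
  obtain ⟨b, hb⟩ := hB
  rw [← h b hb, norm_unitExp]

theorem isUnimodular_of_forall_eq {B : Finset ℤ} (hB : B.Nonempty) {s : ℝ} {κ : ℂ}
    (h : ∀ b ∈ B, unitExp (b * s) = κ) : IsUnimodular B s := by
  have : mB B s = κ := by
    rw [mB_eq_unitExp, Finset.sum_congr rfl h]
    simp [card_ne_zero_complex hB]
  rwa [IsUnimodular, this]

/-- Equality case of the triangle inequality: the variance of the terms about their mean is `1 - ‖mB
B s‖ ^ 2`. -/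
theorem isUnimodular_of_norm_eq_one {B : Finset ℤ} (hB : B.Nonempty) {s : ℝ}
    (h : ‖mB B s‖ = 1) : IsUnimodular B s := by
  have hN := card_ne_zero_complex hB
  have hsum : ∑ b ∈ B, unitExp (b * s) = B.card * mB B s := by
    rw [mB_eq_unitExp, mul_inv_cancel_left₀ hN]
  have hz : ∑ b ∈ B, ‖unitExp (b * s) - mB B s‖ ^ 2 = 0 := by
    have hre : ∀ b ∈ B, ‖unitExp (b * s) - mB B s‖ ^ 2
        = 2 - 2 * (unitExp (b * s) * conj (mB B s)).re := fun b _ => by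
      rw [← Complex.normSq_eq_norm_sq, Complex.normSq_sub, Complex.normSq_eq_norm_sq,
        Complex.normSq_eq_norm_sq, norm_unitExp, h]
      ring
    rw [Finset.sum_congr rfl hre, Finset.sum_sub_distrib, ← Finset.mul_sum, ← Complex.re_sum,
      ← Finset.sum_mul, hsum, mul_assoc, Complex.mul_conj, Complex.normSq_eq_norm_sq, h]
    simp
    ring
  intro b hb
  have := (Finset.sum_eq_zero_iff_of_nonneg (fun b _ => by positivity)).1 hz b hb
  exact sub_eq_zero.1 (norm_eq_zero.1 (pow_eq_zero_iff two_ne_zero |>.1 this))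

/-- Integer shifts change no term, and multiplication by `R` raises the common value to the power
`R`. Thus unimodularity passes from `g_l(t)` back to `t`. -/
theorem IsUnimodular.intCast_add_natCast_mul {B : Finset ℤ} (hB : B.Nonempty) {s : ℝ}
    (h : IsUnimodular B s) (R : ℕ) (l : ℤ) : IsUnimodular B (l + R * s) := by
  refine isUnimodular_of_forall_eq hB (κ := mB B s ^ R) fun b hb => ?_
  have h1 : unitExp ((b : ℝ) * l) = 1 := by exact_mod_cast unitExp_intCast (b * l)
  rw [mul_add, unitExp_add, h1, one_mul, mul_left_comm, unitExp_natCast_mul, h b hb]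

theorem IsUnimodular.norm_mB_sub {B : Finset ℤ} (hB : B.Nonempty) {s : ℝ}
    (h : IsUnimodular B s) (x : ℝ) : ‖mB B (x - s)‖ = ‖mB B x‖ := by
  have : mB B (x - s) = mB B x * conj (mB B s) := by
    rw [mB_eq_unitExp B (x - s), mB_eq_unitExp B x, mul_assoc, Finset.sum_mul]
    congr 1
    refine Finset.sum_congr rfl fun b hb => ?_
    rw [← h b hb, conj_unitExp, ← unitExp_add]
    ring_nf
  rw [this, norm_mul, Complex.norm_conj, h.norm_eq_one hB, mul_one]

/-! ### The isometry relation -/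

/-- The average of `u` over the digits, twisted by the character of the digit `l`. -/
noncomputable def digitAvg (R : ℕ) (B : Finset ℤ) (l : ℤ) (u : ℤ → ℂ) : ℂ :=
  (B.card : ℂ)⁻¹ * ∑ b ∈ B, unitExp (-((R : ℝ)⁻¹ * l * b)) * u b

theorem mB_g_eq_digitAvg (R : ℕ) (B : Finset ℤ) (l : ℤ) (t : ℝ) :
    mB B (g R l t) = digitAvg R B l fun b => unitExp (b * ((R : ℝ)⁻¹ * t)) := by
  rw [mB_eq_unitExp, digitAvg, g]
  congr 1
  refine Finset.sum_congr rfl fun b _ => ?_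
  rw [← unitExp_add]
  ring_nf

variable {R : ℕ} {B L : Finset ℤ} {α : ℤ → ℂ}

theorem sum_weight_mul_unitExp (hB : B.Nonempty)
    (hT : (weightedMatrix R B L α).conjTranspose * weightedMatrix R B L α = 1)
    {b b' : ℤ} (hb : b ∈ B) (hb' : b' ∈ B) :
    ∑ l ∈ L, conj (α l) * α l * unitExp ((R : ℝ)⁻¹ * l * (b' - b)) =
      if b = b' then (B.card : ℂ) else 0 := by
  have h := congrFun (congrFun hT ⟨b, hb⟩) ⟨b', hb'⟩
  have hN := card_ne_zero_complex hB
  rw [Matrix.mul_apply, Matrix.one_apply] at h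
  simp only [Matrix.conjTranspose_apply, weightedMatrix, Matrix.of_apply, Subtype.mk.injEq] at h
  have hs : ((Real.sqrt (B.card : ℝ) : ℝ) : ℂ) * (Real.sqrt (B.card : ℝ) : ℝ) = B.card := by
    rw [← Complex.ofReal_mul, Real.mul_self_sqrt (by positivity)]
    simp
  have key : ∀ l : ℤ, conj (α l) * α l * unitExp ((R : ℝ)⁻¹ * l * (b' - b)) = B.card *
      (star (1 / (Real.sqrt (B.card : ℝ) : ℂ) *
        (Complex.exp (2 * Real.pi * Complex.I * (R : ℂ)⁻¹ * (l : ℂ) * (b : ℂ)) * α l)) *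
      (1 / (Real.sqrt (B.card : ℝ) : ℂ) *
        (Complex.exp (2 * Real.pi * Complex.I * (R : ℂ)⁻¹ * (l : ℂ) * (b' : ℂ)) * α l))) := by
    intro l
    have e1 : ∀ b : ℤ, Complex.exp (2 * Real.pi * Complex.I * (R : ℂ)⁻¹ * (l : ℂ) * (b : ℂ))
        = unitExp ((R : ℝ)⁻¹ * l * b) := fun b => by
      unfold unitExp
      push_cast
      ring_nf
    have hs0 : ((Real.sqrt (B.card : ℝ) : ℝ) : ℂ) ≠ 0 := by
      intro h0
      rw [h0, zero_mul] at hs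
      exact hN hs.symm
    rw [e1, e1, mul_sub, sub_eq_add_neg, unitExp_add, ← conj_unitExp]
    simp only [Complex.star_def, map_mul, map_div₀, map_one, Complex.conj_ofReal]
    rw [← hs]
    field_simp
  rw [Finset.sum_congr rfl fun l _ => key l, ← Finset.mul_sum, ← Finset.sum_coe_sort L, h]
  split_ifs <;> simp

/-- Column orthogonality involves the weights only through `|α_l|²`, so it survives conjugating the
characters; this is its polarized form. -/
theorem sum_conj_digitAvg_mul (hB : B.Nonempty)
    (hT : (weightedMatrix R B L α).conjTranspose * weightedMatrix R B L α = 1)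
    (u v : ℤ → ℂ) :
    ∑ l ∈ L, conj (α l * digitAvg R B l u) * (α l * digitAvg R B l v) =
      (B.card : ℂ)⁻¹ * ∑ b ∈ B, conj (u b) * v b := by
  have hN := card_ne_zero_complex hB
  have h1 : ∀ l, conj (α l * digitAvg R B l u) * (α l * digitAvg R B l v) =
      ∑ b ∈ B, ∑ b' ∈ B, (B.card : ℂ)⁻¹ * (B.card : ℂ)⁻¹ * (conj (u b) * v b') *
        (conj (α l) * α l * unitExp ((R : ℝ)⁻¹ * l * (b - b'))) := by
    intro l
    simp only [digitAvg, map_mul, map_sum, map_inv₀, Complex.conj_natCast, conj_unitExp, neg_neg]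
    calc _ = (B.card : ℂ)⁻¹ * (B.card : ℂ)⁻¹ * (conj (α l) * α l) *
          ((∑ b ∈ B, unitExp ((R : ℝ)⁻¹ * l * b) * conj (u b)) *
            ∑ b ∈ B, unitExp (-((R : ℝ)⁻¹ * l * b)) * v b) := by ring
      _ = _ := by
        rw [Finset.sum_mul_sum, Finset.mul_sum]
        refine Finset.sum_congr rfl fun b _ => ?_
        rw [Finset.mul_sum]
        refine Finset.sum_congr rfl fun b' _ => ?_
        rw [mul_sub, sub_eq_add_neg ((R : ℝ)⁻¹ * l * b), unitExp_add]
        ring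
  rw [Finset.sum_congr rfl fun l _ => h1 l, Finset.sum_comm, Finset.mul_sum]
  refine Finset.sum_congr rfl fun b hb => ?_
  rw [Finset.sum_comm]
  rw [Finset.sum_congr rfl fun b' hb' => by
    rw [← Finset.mul_sum, sum_weight_mul_unitExp hB hT hb' hb]]
  simp only [mul_ite, mul_zero, Finset.sum_ite_eq', hb, if_true]
  field_simp

theorem sum_norm_digitAvg_sq (hB : B.Nonempty)
    (hT : (weightedMatrix R B L α).conjTranspose * weightedMatrix R B L α = 1) (u : ℤ → ℂ) :
    ∑ l ∈ L, ‖α l * digitAvg R B l u‖ ^ 2 = (B.card : ℝ)⁻¹ * ∑ b ∈ B, ‖u b‖ ^ 2 := by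
  have h := sum_conj_digitAvg_mul hB hT u u
  simp only [Complex.conj_mul'] at h
  apply Complex.ofReal_injective
  push_cast at h ⊢
  exact h

theorem sum_norm_mB_sq (hB : B.Nonempty)
    (hT : (weightedMatrix R B L α).conjTranspose * weightedMatrix R B L α = 1) (t : ℝ) :
    ∑ l ∈ L, ‖α l * mB B (g R l t)‖ ^ 2 = 1 := by
  have hN : (B.card : ℝ) ≠ 0 := by exact_mod_cast hB.card_pos.ne'
  simp only [mB_g_eq_digitAvg]
  rw [sum_norm_digitAvg_sq hB hT]
  simp [hN]

theorem sum_conj_mB_mul (hB : B.Nonempty)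
    (hT : (weightedMatrix R B L α).conjTranspose * weightedMatrix R B L α = 1) (t t' : ℝ) :
    ∑ l ∈ L, conj (α l * mB B (g R l t)) * (α l * mB B (g R l t')) =
      mB B ((R : ℝ)⁻¹ * (t' - t)) := by
  simp only [mB_g_eq_digitAvg]
  rw [sum_conj_digitAvg_mul hB hT, mB_eq_unitExp]
  congr 1
  refine Finset.sum_congr rfl fun b _ => ?_
  rw [conj_unitExp, ← unitExp_add]
  ring_nf

theorem natCast_pos_of_two_le (hR : 2 ≤ R) : (0 : ℝ) < R := by
  have : 0 < R := by omega
  exact_mod_cast this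

theorem g_intCast_add_mul (hR : 2 ≤ R) (l : ℤ) (s : ℝ) : g R l (l + R * s) = s := by
  have := (natCast_pos_of_two_le hR).ne'
  unfold g
  field_simp
  ring

theorem intCast_add_mul_g (hR : 2 ≤ R) (l : ℤ) (t : ℝ) : (l : ℝ) + R * g R l t = t := by
  have := (natCast_pos_of_two_le hR).ne'
  unfold g
  field_simp
  ring

theorem sum_weight_le_one (hB : B.Nonempty)
    (hT : (weightedMatrix R B L α).conjTranspose * weightedMatrix R B L α = 1) (t : ℝ)
    (S : Finset ℤ) (hS : S ⊆ L) (h : ∀ l ∈ S, IsUnimodular B (g R l t)) :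
    ∑ l ∈ S, ‖α l‖ ^ 2 ≤ 1 := by
  rw [← sum_norm_mB_sq hB hT t]
  refine le_trans (le_of_eq (Finset.sum_congr rfl fun l hl => ?_))
    (Finset.sum_le_sum_of_subset_of_nonneg hS fun _ _ _ => by positivity)
  rw [norm_mul, (h l hl).norm_eq_one hB, mul_one]

/-! ### Finite invariant sets -/

theorem exists_stepPossible (hB : B.Nonempty)
    (hT : (weightedMatrix R B L α).conjTranspose * weightedMatrix R B L α = 1) (t : ℝ) :
    ∃ l ∈ L, StepPossible R B α l t := by
  by_contra! h
  have := sum_norm_mB_sq hB hT t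
  rw [Finset.sum_eq_zero fun l hl => ?_] at this
  · exact zero_ne_one this
  · simp [not_not.1 (h l hl)]

/-- Modulo 1, every point of `K` is `R` times the target of a possible transition. Multiplication by
`R` therefore maps the finite image of `K` onto a set containing that image, and by counting it is
injective there. -/
theorem exists_intCast_eq_sub_g (hB : B.Nonempty) (hR : 2 ≤ R)
    (hT : (weightedMatrix R B L α).conjTranspose * weightedMatrix R B L α = 1)
    {K : Set ℝ} (hK : K.Finite) (hinv : IsInvariant R B L α K) {x y : ℝ} (hx : x ∈ K)
    (hy : y ∈ K) (hxy : ∃ n : ℤ, R * x - R * y = n) : ∃ n : ℤ, x - y = n := by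
  classical
  let π : ℝ → UnitAddCircle := fun x => (x : UnitAddCircle)
  have hπ : ∀ a b : ℝ, π a = π b ↔ ∃ n : ℤ, a - b = n := fun a b => by
    rw [← sub_eq_zero, ← AddCircle.coe_sub, AddCircle.coe_eq_zero_iff]
    exact exists_congr fun n => by simp [eq_comm]
  set P : Finset UnitAddCircle := hK.toFinset.image π with hP
  have hsub : P ⊆ P.image fun z => R • z := by
    intro z hz
    obtain ⟨t, ht, rfl⟩ := Finset.mem_image.1 hz
    rw [hK.mem_toFinset] at ht
    obtain ⟨l, hl, hpos⟩ := exists_stepPossible hB hT t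
    refine Finset.mem_image.2 ⟨π (g R l t), Finset.mem_image_of_mem _
      (hK.mem_toFinset.2 (hinv t ht l hl hpos)), ?_⟩
    have h1 : R • π (g R l t) = π (R * g R l t) := by
      simp only [π]
      rw [← AddCircle.coe_nsmul, nsmul_eq_mul]
    rw [h1, hπ]
    exact ⟨-l, by have := intCast_add_mul_g hR l t; push_cast; linarith⟩
  have hinj : Set.InjOn (fun z : UnitAddCircle => R • z) P :=
    Finset.card_image_iff.1 (le_antisymm Finset.card_image_le (Finset.card_le_card hsub))
  rw [← hπ]
  refine hinj (Finset.mem_image_of_mem _ (hK.mem_toFinset.2 hx))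
    (Finset.mem_image_of_mem _ (hK.mem_toFinset.2 hy)) ?_
  simp only [π]
  rw [← AddCircle.coe_nsmul, ← AddCircle.coe_nsmul, nsmul_eq_mul, nsmul_eq_mul]
  exact (hπ _ _).2 hxy

/-- All possible targets from `t` are congruent modulo 1, so `mB` takes a single value `m` on them
and `|m|² ∑ |α_k|² = 1` over the possible digits. It remains to see that these weights sum to at
most 1. -/
theorem IsInvariant.isUnimodular_g (hB : B.Nonempty) (hR : 2 ≤ R)
    (hT : (weightedMatrix R B L α).conjTranspose * weightedMatrix R B L α = 1)
    {K : Set ℝ} (hinv : IsInvariant R B L α K) (hK : K.Finite) {t : ℝ} (ht : t ∈ K)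
    {l : ℤ} (hl : l ∈ L) (hpos : StepPossible R B α l t) : IsUnimodular B (g R l t) := by
  classical
  set S := L.filter fun k => StepPossible R B α k t with hS
  have hint : ∀ k ∈ S, ∃ n : ℤ, g R k t = g R l t + n := by
    intro k hk
    obtain ⟨hkL, hkp⟩ := Finset.mem_filter.1 hk
    obtain ⟨n, hn⟩ := exists_intCast_eq_sub_g hB hR hT hK hinv (hinv t ht k hkL hkp)
      (hinv t ht l hl hpos) ⟨l - k, by
        have h1 := intCast_add_mul_g hR k t
        have h2 := intCast_add_mul_g hR l t
        push_cast
        linarith⟩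
    exact ⟨n, by linarith⟩
  have hmB : ∀ k ∈ S, mB B (g R k t) = mB B (g R l t) := fun k hk => by
    obtain ⟨n, hn⟩ := hint k hk
    rw [hn, mB_add_intCast]
  have hone : ∀ n : ℤ, IsUnimodular B (n : ℝ) := fun n =>
    isUnimodular_of_norm_eq_one hB (by
      have := mB_add_intCast B 0 n
      rw [zero_add] at this
      rw [this, mB_zero hB, norm_one])
  -- The base point is the digit `l` itself: `g_k(l) = g_k(t) - g_l(t)` is an integer for each
  -- possible `k`, and integers are unimodular.
  have hw : ∑ k ∈ S, ‖α k‖ ^ 2 ≤ 1 := by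
    refine sum_weight_le_one hB hT (l : ℝ) S (Finset.filter_subset _ _) fun k hk => ?_
    obtain ⟨n, hn⟩ := hint k hk
    have : g R k l = n := by
      unfold g at hn ⊢
      rw [mul_sub, mul_sub] at *
      linarith
    rw [this]
    exact hone n
  have hsum : (∑ k ∈ S, ‖α k‖ ^ 2) * ‖mB B (g R l t)‖ ^ 2 = 1 := by
    rw [← sum_norm_mB_sq hB hT t, Finset.sum_mul, hS, Finset.sum_filter]
    refine Finset.sum_congr rfl fun k hk => ?_
    split_ifs with h
    · rw [norm_mul, mul_pow, hmB k (Finset.mem_filter.2 ⟨hk, h⟩)]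
    · simp [not_not.1 h]
  have h1 : 1 ≤ ‖mB B (g R l t)‖ ^ 2 := by
    nlinarith [sq_nonneg ‖mB B (g R l t)‖]
  refine isUnimodular_of_norm_eq_one hB (le_antisymm (norm_mB_le_one _ _) ?_)
  nlinarith [norm_nonneg (mB B (g R l t))]

/-- Applied to the Fourier transform of `μ`, this is orthogonality of the exponentials. For a
closest non-orthogonal pair, the polarized isometry relation gives a digit possible from both
points; applying it yields another such pair, closer by the factor `R`. -/
theorem IsInvariant.apply_sub_eq_zero (hB : B.Nonempty) (hR : 2 ≤ R)
    (hT : (weightedMatrix R B L α).conjTranspose * weightedMatrix R B L α = 1)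
    {K : Set ℝ} (hinv : IsInvariant R B L α K) (hK : K.Finite) {φ : ℝ → ℂ}
    (hφ : ∀ s, φ s = mB B ((R : ℝ)⁻¹ * s) * φ ((R : ℝ)⁻¹ * s)) {x y : ℝ} (hx : x ∈ K)
    (hy : y ∈ K) (hxy : x ≠ y) : φ (y - x) = 0 := by
  by_contra hne
  set Q : Set (ℝ × ℝ) := {p ∈ K ×ˢ K | p.1 ≠ p.2 ∧ φ (p.2 - p.1) ≠ 0}
  have hQ : Q.Finite := (hK.prod hK).subset fun p hp => hp.1
  obtain ⟨p, ⟨⟨hp1, hp2⟩, hpne, hpφ⟩, hmin⟩ :=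
    hQ.exists_minimalFor (fun p => |p.2 - p.1|) Q ⟨(x, y), ⟨hx, hy⟩, hxy, hne⟩
  rw [hφ] at hpφ
  obtain ⟨hm, hφ'⟩ := mul_ne_zero_iff.1 hpφ
  rw [← sum_conj_mB_mul hB hT] at hm
  obtain ⟨l, hl, hprod⟩ := Finset.exists_ne_zero_of_sum_ne_zero hm
  obtain ⟨h1, h2⟩ := mul_ne_zero_iff.1 hprod
  have h1' : StepPossible R B α l p.1 := fun h0 => h1 (by simp [h0])
  have hd : g R l p.2 - g R l p.1 = (R : ℝ)⁻¹ * (p.2 - p.1) := by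
    unfold g
    ring
  have hRpos := natCast_pos_of_two_le hR
  have hlt : |g R l p.2 - g R l p.1| < |p.2 - p.1| := by
    rw [hd, abs_mul, abs_of_pos (inv_pos.2 hRpos)]
    exact mul_lt_of_lt_one_left (abs_pos.2 (sub_ne_zero.2 hpne.symm)) (inv_natCast_lt_one hR)
  have hmem : (g R l p.1, g R l p.2) ∈ Q := by
    refine ⟨⟨hinv _ hp1 l hl h1', hinv _ hp2 l hl h2⟩, fun h => ?_, by simpa only [hd] using hφ'⟩
    have : (R : ℝ)⁻¹ * (p.2 - p.1) = 0 := by rw [← hd, sub_eq_zero]; exact h.symm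
    rcases mul_eq_zero.1 this with h | h
    · exact (inv_pos.2 hRpos).ne' h
    · exact hpne (sub_eq_zero.1 h).symm
  exact absurd (hmin hmem hlt.le) (not_le.2 hlt)

theorem IsInvariant.union {K K' : Set ℝ} (h : IsInvariant R B L α K)
    (h' : IsInvariant R B L α K') : IsInvariant R B L α (K ∪ K') := fun t ht l hl hp =>
  ht.imp (fun ht => h t ht l hl hp) fun ht => h' t ht l hl hp

theorem IsInvariant.inter {K K' : Set ℝ} (h : IsInvariant R B L α K)
    (h' : IsInvariant R B L α K') : IsInvariant R B L α (K ∩ K') := fun t ht l hl hp =>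
  ⟨h t ht.1 l hl hp, h' t ht.2 l hl hp⟩

/-! ### Min-sets -/

theorem IsMinSet.isInvariant {M : Set ℝ} (h : IsMinSet R B L α M) : IsInvariant R B L α M :=
  h.2.prop.2

theorem IsMinSet.eq_of_mem {M M' : Set ℝ} (h : IsMinSet R B L α M) (h' : IsMinSet R B L α M')
    {t : ℝ} (ht : t ∈ M) (ht' : t ∈ M') : M = M' := by
  have hi : (M ∩ M').Nonempty ∧ IsInvariant R B L α (M ∩ M') :=
    ⟨⟨t, ht, ht'⟩, h.isInvariant.inter h'.isInvariant⟩
  have h1 := h.2.le_of_le hi Set.inter_subset_left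
  have h2 := h'.2.le_of_le hi Set.inter_subset_right
  exact Set.Subset.antisymm (fun x hx => (h1 hx).2) fun x hx => (h2 hx).1

theorem exists_isMinSet_subset {K : Set ℝ} (hK : K.Finite) (hne : K.Nonempty)
    (hinv : IsInvariant R B L α K) : ∃ M ⊆ K, IsMinSet R B L α M := by
  obtain ⟨M, hMK, hM⟩ := (hK.finite_subsets.inter_of_left
    {A | A.Nonempty ∧ IsInvariant R B L α A}).exists_le_minimal
    ⟨Set.Subset.refl K, hne, hinv⟩
  refine ⟨M, hMK, hK.subset hMK, hM.prop.2, fun A hA hAM => ?_⟩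
  exact hM.le_of_le ⟨hAM.trans hMK, hA⟩ hAM

/-- The targets of possible transitions form a non-empty invariant subset, so by minimality every
point is such a target. -/
theorem IsMinSet.isUnimodular (hB : B.Nonempty) (hR : 2 ≤ R)
    (hT : (weightedMatrix R B L α).conjTranspose * weightedMatrix R B L α = 1)
    {M : Set ℝ} (h : IsMinSet R B L α M) {t : ℝ} (ht : t ∈ M) : IsUnimodular B t := by
  set A : Set ℝ := {s | ∃ x ∈ M, ∃ l ∈ L, StepPossible R B α l x ∧ g R l x = s}
  have hAM : A ⊆ M := by
    rintro _ ⟨x, hx, l, hl, hp, rfl⟩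
    exact h.isInvariant x hx l hl hp
  have hA : A.Nonempty ∧ IsInvariant R B L α A := by
    refine ⟨?_, fun x hx l hl hp => ⟨x, hAM hx, l, hl, hp, rfl⟩⟩
    obtain ⟨l, hl, hp⟩ := exists_stepPossible hB hT t
    exact ⟨_, t, ht, l, hl, hp, rfl⟩
  obtain ⟨x, hx, l, hl, hp, rfl⟩ := h.2.le_of_le hA hAM ht
  exact h.isInvariant.isUnimodular_g hB hR hT h.1 hx hl hp

/-- At the point 0 the digit 0 already has probability 1, so no other digit is possible. -/
theorem isMinSet_singleton_zero (hB : B.Nonempty)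
    (hT : (weightedMatrix R B L α).conjTranspose * weightedMatrix R B L α = 1)
    (h0L : (0 : ℤ) ∈ L) (hα0 : α 0 = 1) : IsMinSet R B L α {0} := by
  refine ⟨Set.finite_singleton 0, ⟨Set.singleton_nonempty 0, ?_⟩, fun A hA hA0 => ?_⟩
  · rintro t rfl l hl hp
    have hg : g R 0 0 = 0 := by simp [g]
    by_cases h0 : l = 0
    · rw [h0]
      exact hg
    · have hs := sum_norm_mB_sq hB hT 0
      rw [← Finset.add_sum_erase _ _ h0L, hg, hα0, mB_zero hB] at hs
      have hz : ∑ x ∈ L.erase 0, ‖α x * mB B (g R x 0)‖ ^ 2 = 0 := by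
        simpa using hs
      have := (Finset.sum_eq_zero_iff_of_nonneg fun _ _ => by positivity).1 hz l
        (Finset.mem_erase.2 ⟨h0, hl⟩)
      exact absurd (norm_eq_zero.1 (pow_eq_zero_iff two_ne_zero |>.1 this)) hp
  · rw [Set.subset_singleton_iff_eq.1 hA0 |>.resolve_left hA.1.ne_empty]

/-! ### Words -/

@[simp]
theorem wordWeight_nil : wordWeight α ([] : List L) = 1 := by simp [wordWeight]

theorem wordWeight_cons (l : L) (w : List L) :
    wordWeight α (l :: w) = α l * wordWeight α w := by
  simp [wordWeight, Fin.prod_univ_succ]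

theorem wordWeight_append (u v : List L) :
    wordWeight α (u ++ v) = wordWeight α u * wordWeight α v := by
  induction u with
  | nil => simp
  | cons l u ih => rw [List.cons_append, wordWeight_cons, wordWeight_cons, ih, mul_assoc]

@[simp]
theorem wordFreq_nil (c : ℝ) : wordFreq R ([] : List L) c = c := by simp [wordFreq]

theorem wordFreq_cons (l : L) (w : List L) (c : ℝ) :
    wordFreq R (l :: w) c = ((l : ℤ) : ℝ) + R * wordFreq R w c := by
  simp only [wordFreq, List.length_cons, Fin.sum_univ_succ, mul_add, Finset.mul_sum]
  simp [pow_succ', mul_assoc, add_assoc]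

@[simp]
theorem wordAct_nil (t : ℝ) : wordAct R ([] : List L) t = t := rfl

theorem wordAct_cons (l : L) (w : List L) (t : ℝ) :
    wordAct R (l :: w) t = wordAct R w (g R l t) := rfl

theorem wordAct_append (u v : List L) (t : ℝ) :
    wordAct R (u ++ v) t = wordAct R v (wordAct R u t) := by
  induction u generalizing t with
  | nil => rfl
  | cons l u ih => rw [List.cons_append, wordAct_cons, wordAct_cons, ih]

/-- The frequencies of the family are thus the starting points from which a word leads to `c`. -/
theorem wordAct_eq_iff (hR : 2 ≤ R) (w : List L) (t c : ℝ) :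
    wordAct R w t = c ↔ t = wordFreq R w c := by
  induction w generalizing t with
  | nil => simp
  | cons l w ih =>
    rw [wordAct_cons, ih, wordFreq_cons]
    constructor
    · intro h
      rw [← h, intCast_add_mul_g hR]
    · rintro rfl
      exact g_intCast_add_mul hR _ _

theorem IsUnimodular.wordFreq (hB : B.Nonempty) {c : ℝ} (hc : IsUnimodular B c) (w : List L) :
    IsUnimodular B (wordFreq R w c) := by
  induction w with
  | nil => simpa
  | cons l w ih =>
    rw [wordFreq_cons]
    exact ih.intCast_add_natCast_mul hB R l

theorem IsUnimodular.of_wordAct (hB : B.Nonempty) (hR : 2 ≤ R) {w : List L} {t : ℝ}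
    (h : IsUnimodular B (wordAct R w t)) : IsUnimodular B t := by
  rw [(wordAct_eq_iff hR w t _).1 rfl]
  exact h.wordFreq hB w

theorem IsUnimodular.of_g (hB : B.Nonempty) (hR : 2 ≤ R) {l : ℤ} {t : ℝ}
    (h : IsUnimodular B (g R l t)) : IsUnimodular B t := by
  rw [← intCast_add_mul_g hR l t]
  exact h.intCast_add_natCast_mul hB R l

theorem IsUnimodular.stepPossible (hB : B.Nonempty) {l : ℤ} {t : ℝ}
    (h : IsUnimodular B (g R l t)) (hl : α l ≠ 0) : StepPossible R B α l t :=
  mul_ne_zero hl fun h0 => by simpa [h0] using h.norm_eq_one hB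

/-- Unimodularity of the end point propagates back along the word; with a non-zero weight it makes
every transition possible. -/
theorem IsInvariant.wordAct_mem (hB : B.Nonempty) (hR : 2 ≤ R) {K : Set ℝ}
    (hK : IsInvariant R B L α K) {w : List L} {t : ℝ} (ht : t ∈ K)
    (hw : wordWeight α w ≠ 0) (h : IsUnimodular B (wordAct R w t)) : wordAct R w t ∈ K := by
  induction w generalizing t with
  | nil => exact ht
  | cons l w ih =>
    rw [wordWeight_cons] at hw
    obtain ⟨h1, h2⟩ := mul_ne_zero_iff.1 hw
    rw [wordAct_cons] at h ⊢
    exact ih (hK t ht l l.2 ((h.of_wordAct hB hR).stepPossible hB h1)) h2 h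

/-- Cut the closed word at an intermediate return to `c` and keep the rest, until no intermediate
return is left. -/
theorem exists_isCycleWord_suffix (hB : B.Nonempty) (hR : 2 ≤ R) {c : ℝ}
    (hc : IsUnimodular B c) (w : List L) (hne : w ≠ []) (hw : wordAct R w c = c)
    (hweight : wordWeight α w ≠ 0) : ∃ u v : List L, w = u ++ v ∧ IsCycleWord R B α c v := by
  induction h : w.length using Nat.strong_induction_on generalizing w with
  | _ n ih =>
    by_cases hret : ∀ k : ℕ, 0 < k → k < w.length → wordAct R (w.take k) c ≠ c
    · refine ⟨[], w, rfl, hne, hw, hret, fun k => ?_⟩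
      refine IsUnimodular.stepPossible hB ?_ ?_
      · have h1 : w = w.take (k + 1) ++ w.drop (k + 1) := (List.take_append_drop _ _).symm
        have h2 : g R (w.get k : L) (wordAct R (w.take k) c) = wordAct R (w.take (k + 1)) c := by
          rw [List.take_succ_eq_append_getElem k.2, wordAct_append]
          rfl
        rw [h2]
        refine IsUnimodular.of_wordAct hB hR (w := w.drop (k + 1)) ?_
        rwa [← wordAct_append, ← h1, hw]
      · exact Finset.prod_ne_zero_iff.1 hweight k (Finset.mem_univ _)
    · push Not at hret
      obtain ⟨k, hk0, hkl, hk⟩ := hret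
      have h1 : w = w.take k ++ w.drop k := (List.take_append_drop _ _).symm
      have h2 : wordAct R (w.drop k) c = c := by
        rw [h1, wordAct_append, hk] at hw
        exact hw
      have h3 : wordWeight α (w.drop k) ≠ 0 := by
        rw [h1, wordWeight_append] at hweight
        exact right_ne_zero_of_mul hweight
      obtain ⟨u, v, huv, hv⟩ := ih (w.drop k).length (by rw [List.length_drop]; omega) (w.drop k)
        (by rw [← List.length_pos_iff_ne_nil, List.length_drop]; omega) h2 h3 rfl
      exact ⟨w.take k ++ u, v, by rw [List.append_assoc, ← huv, ← h1], hv⟩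

theorem nil_mem_Omega (c : ℝ) : ([] : List L) ∈ Omega R B L α c := by
  rintro ⟨u, v, huv, hv⟩
  exact hv.1 (List.append_eq_nil_iff.1 huv.symm).2

theorem mem_Omega_of_cons {c : ℝ} {l : L} {w : List L} (h : l :: w ∈ Omega R B L α c) :
    w ∈ Omega R B L α c := by
  rintro ⟨u, v, rfl, hv⟩
  exact h ⟨l :: u, v, rfl, hv⟩

theorem wordAct_cons_eq_of_notMem_Omega {c : ℝ} {l : L} {w : List L}
    (h : w ∈ Omega R B L α c) (h' : l :: w ∉ Omega R B L α c) : wordAct R (l :: w) c = c := by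
  obtain ⟨u, v, huv, hv⟩ := not_not.1 h'
  cases u with
  | nil => rw [huv]; exact hv.2.1
  | cons a u =>
    rw [List.cons_append, List.cons.injEq] at huv
    exact absurd ⟨u, v, huv.2, hv⟩ h

theorem tsum_list {β : Type*} (f : List β → ℝ≥0∞) :
    ∑' w, f w = f [] + ∑' l, ∑' w, f (l :: w) := by
  let e : Unit ⊕ β × List β ≃ List β :=
    { toFun := Sum.elim (fun _ => []) fun p => p.1 :: p.2
      invFun := fun w => match w with
        | [] => Sum.inl ()
        | l :: w => Sum.inr (l, w)
      left_inv := by rintro (_ | _) <;> rfl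
      right_inv := by rintro (_ | _) <;> rfl }
  rw [← e.tsum_eq, ENNReal.summable.tsum_sum ENNReal.summable, ENNReal.tsum_prod']
  simp [e]

/-! ### Reaching probabilities -/

/-- The total squared weight of the words of length `n` that lead from `t` into `C`. -/
noncomputable def reach (R : ℕ) (L : Finset ℤ) (α : ℤ → ℂ) (C : Set ℝ) : ℕ → ℝ → ℝ≥0∞
  | 0, t => C.indicator 1 t
  | n + 1, t => ∑ l ∈ L, ‖α l‖ₑ ^ 2 * reach R L α C n (g R l t)

theorem enorm_sq_eq_ofReal {E : Type*} [SeminormedAddCommGroup E] (z : E) :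
    ‖z‖ₑ ^ 2 = ENNReal.ofReal (‖z‖ ^ 2) := by
  rw [ENNReal.ofReal_pow (norm_nonneg _), ofReal_norm]

theorem sum_enorm_sq_mul_indicator_le_one (hB : B.Nonempty)
    (hT : (weightedMatrix R B L α).conjTranspose * weightedMatrix R B L α = 1) (t : ℝ) :
    ∑ l ∈ L, ‖α l‖ₑ ^ 2 * {s | IsUnimodular B s}.indicator 1 (g R l t) ≤ 1 := by
  classical
  have h := sum_weight_le_one hB hT t (L.filter fun l => IsUnimodular B (g R l t))
    (Finset.filter_subset _ _) fun l hl => (Finset.mem_filter.1 hl).2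
  refine le_trans (le_of_eq ?_) (ENNReal.ofReal_le_one.2 h)
  rw [ENNReal.ofReal_sum_of_nonneg fun _ _ => by positivity, Finset.sum_filter]
  refine Finset.sum_congr rfl fun l _ => ?_
  rw [← enorm_sq_eq_ofReal, Set.indicator_apply]
  simp

/-- A point with a unimodular target is unimodular, and the weights `|α_l|²` of the digits with
unimodular targets sum to at most 1. -/
theorem reach_le_indicator (hB : B.Nonempty) (hR : 2 ≤ R)
    (hT : (weightedMatrix R B L α).conjTranspose * weightedMatrix R B L α = 1)
    {C : Set ℝ} (hC : ∀ t ∈ C, IsUnimodular B t) (n : ℕ) (t : ℝ) :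
    reach R L α C n t ≤ {s | IsUnimodular B s}.indicator 1 t := by
  induction n generalizing t with
  | zero => exact Set.indicator_le_indicator_of_subset hC (fun _ => zero_le_one) t
  | succ n ih =>
    by_cases ht : IsUnimodular B t
    · rw [Set.indicator_of_mem (by exact ht)]
      refine le_trans (Finset.sum_le_sum fun l _ => ?_)
        (sum_enorm_sq_mul_indicator_le_one hB hT t)
      gcongr
      exact ih _
    · refine le_trans (le_of_eq ?_) zero_le
      refine Finset.sum_eq_zero fun l _ => ?_
      have := ih (g R l t)
      rw [Set.indicator_of_notMem fun h : IsUnimodular B (g R l t) => ht (h.of_g hB hR)] at this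
      rw [le_antisymm this zero_le, mul_zero]

/-- The walk never leaves `C`, and `|α_l|²` is at least the transition probability because `|m_B| ≤
1`. -/
theorem one_le_reach (hB : B.Nonempty)
    (hT : (weightedMatrix R B L α).conjTranspose * weightedMatrix R B L α = 1)
    {C : Set ℝ} (hinv : IsInvariant R B L α C) (n : ℕ) {t : ℝ}
    (ht : t ∈ C) : 1 ≤ reach R L α C n t := by
  induction n generalizing t with
  | zero => simp [reach, ht]
  | succ n ih =>
    rw [← ENNReal.ofReal_one, ← sum_norm_mB_sq hB hT t,
      ENNReal.ofReal_sum_of_nonneg fun _ _ => by positivity]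
    refine Finset.sum_le_sum fun l hl => ?_
    by_cases hp : StepPossible R B α l t
    · rw [enorm_sq_eq_ofReal]
      refine le_trans (ENNReal.ofReal_le_ofReal ?_)
        (le_mul_of_one_le_right' (ih (hinv t ht l hl hp)))
      rw [norm_mul]
      exact pow_le_pow_left₀ (by positivity)
        (mul_le_of_le_one_right (norm_nonneg _) (norm_mB_le_one _ _)) 2
    · simp [not_not.1 hp]

/-- The union of all min-sets. -/
def minSetUnion (R : ℕ) (B L : Finset ℤ) (α : ℤ → ℂ) : Set ℝ :=
  {t | ∃ M, IsMinSet R B L α M ∧ t ∈ M}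

theorem isInvariant_minSetUnion : IsInvariant R B L α (minSetUnion R B L α) := by
  rintro t ⟨M, hM, ht⟩ l hl hp
  exact ⟨M, hM, hM.isInvariant t ht l hl hp⟩

theorem isUnimodular_of_mem_minSetUnion (hB : B.Nonempty) (hR : 2 ≤ R)
    (hT : (weightedMatrix R B L α).conjTranspose * weightedMatrix R B L α = 1) {t : ℝ}
    (ht : t ∈ minSetUnion R B L α) : IsUnimodular B t := by
  obtain ⟨M, hM, ht⟩ := ht
  exact hM.isUnimodular hB hR hT ht

/-- The total squared weight of the words of length at most `n` in `Ω(c)` that lead from `t`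
to `c`. -/
noncomputable def hit (R : ℕ) (B L : Finset ℤ) (α : ℤ → ℂ) (c : ℝ) (n : ℕ) (t : ℝ) : ℝ≥0∞ :=
  ∑' w : List L, {w | w ∈ Omega R B L α c ∧ w.length ≤ n ∧ wordAct R w t = c}.indicator
    (fun w => ‖wordWeight α w‖ₑ ^ 2) w

theorem hit_succ_le {c t : ℝ} (h : t ≠ c) (n : ℕ) :
    hit R B L α c (n + 1) t ≤ ∑' l : L, ‖α l‖ₑ ^ 2 * hit R B L α c n (g R l t) := by
  unfold hit
  rw [tsum_list, Set.indicator_of_notMem (fun h' => h h'.2.2), zero_add]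
  refine ENNReal.tsum_le_tsum fun l => ?_
  rw [← ENNReal.tsum_mul_left]
  refine ENNReal.tsum_le_tsum fun w => ?_
  by_cases hw : l :: w ∈ {w | w ∈ Omega R B L α c ∧ w.length ≤ n + 1 ∧ wordAct R w t = c}
  · rw [Set.indicator_of_mem hw, Set.indicator_of_mem, wordWeight_cons, enorm_mul, mul_pow]
    exact ⟨mem_Omega_of_cons hw.1, Nat.le_of_succ_le_succ hw.2.1, hw.2.2⟩
  · rw [Set.indicator_of_notMem hw]
    exact zero_le

/-! ### Words of `Ω` compared with reaching probabilities -/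

section Points

variable {c : {M : Set ℝ // IsMinSet R B L α M} → ℝ}

/-- Words stopped at a chosen point within `n` steps weigh no more than words of length exactly `n`
ending anywhere in the min-sets, since a stopped walk can be continued. At `t = c M` only the empty
word counts: a word of non-zero weight to another chosen point would leave `M`, and a non-empty one
back to `c M` ends in a cycle word. Elsewhere the first digit is split off. -/
theorem tsum_hit_le_reach (hB : B.Nonempty) (hR : 2 ≤ R)
    (hT : (weightedMatrix R B L α).conjTranspose * weightedMatrix R B L α = 1)
    (hc : ∀ M, c M ∈ M.1) (n : ℕ) (t : ℝ) :
    ∑' M, hit R B L α (c M) n t ≤ reach R L α (minSetUnion R B L α) n t := by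
  by_cases ht : ∃ M, t = c M
  · obtain ⟨M, rfl⟩ := ht
    refine le_trans ?_ (one_le_reach hB hT isInvariant_minSetUnion n ⟨M.1, M.2, hc M⟩)
    have hz : ∀ M' w, ¬ (M' = M ∧ w = []) →
        {w | w ∈ Omega R B L α (c M') ∧ w.length ≤ n ∧ wordAct R w (c M) = c M'}.indicator
          (fun w => ‖wordWeight α w‖ₑ ^ 2) w = 0 := by
      intro M' w hne
      rw [Set.indicator_apply_eq_zero]
      rintro ⟨hΩ, -, hact⟩
      by_contra hw
      have hw : wordWeight α w ≠ 0 := fun h0 => hw (by simp [h0])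
      have hu : IsUnimodular B (wordAct R w (c M)) := by
        rw [hact]
        exact M'.2.isUnimodular hB hR hT (hc M')
      have hmem := M.2.isInvariant.wordAct_mem hB hR (hc M) hw hu
      rw [hact] at hmem
      have hMM : M' = M := Subtype.ext (M'.2.eq_of_mem M.2 (hc M') hmem)
      subst hMM
      refine hΩ (exists_isCycleWord_suffix hB hR (hact ▸ hu) w (fun h => hne ⟨rfl, h⟩) hact hw)
    unfold hit
    rw [tsum_eq_single M fun M' hM' => ENNReal.tsum_eq_zero.2 fun w => hz M' w fun h => hM' h.1,
      tsum_eq_single [] fun w hw => hz M w fun h => hw h.2]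
    refine (Set.indicator_le_self _ _ _).trans ?_
    simp
  · push Not at ht
    cases n with
    | zero =>
      refine le_trans (le_of_eq ?_) zero_le
      refine ENNReal.tsum_eq_zero.2 fun M => ENNReal.tsum_eq_zero.2 fun w => ?_
      refine Set.indicator_of_notMem ?_ _
      rintro ⟨-, h0, hact⟩
      rw [List.length_eq_zero_iff.1 (Nat.le_zero.1 h0)] at hact
      exact ht M hact
    | succ n =>
      refine (ENNReal.tsum_le_tsum fun M => hit_succ_le (ht M) n).trans ?_
      rw [ENNReal.tsum_comm, reach, ← Finset.tsum_subtype']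
      refine ENNReal.tsum_le_tsum fun l => ?_
      rw [ENNReal.tsum_mul_left]
      gcongr
      exact tsum_hit_le_reach hB hR hT hc n _

theorem hit_le_indicator (hB : B.Nonempty) (hR : 2 ≤ R)
    (hT : (weightedMatrix R B L α).conjTranspose * weightedMatrix R B L α = 1)
    (hc : ∀ M, c M ∈ M.1) (M : {M : Set ℝ // IsMinSet R B L α M}) (n : ℕ) (t : ℝ) :
    hit R B L α (c M) n t ≤ {s | IsUnimodular B s}.indicator 1 t :=
  (ENNReal.le_tsum M).trans ((tsum_hit_le_reach hB hR hT hc n t).trans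
    (reach_le_indicator hB hR hT (fun _ => isUnimodular_of_mem_minSetUnion hB hR hT) n t))

theorem tsum_Omega_le_indicator (hB : B.Nonempty) (hR : 2 ≤ R)
    (hT : (weightedMatrix R B L α).conjTranspose * weightedMatrix R B L α = 1)
    (hc : ∀ M, c M ∈ M.1) (M : {M : Set ℝ // IsMinSet R B L α M}) (t : ℝ) :
    ∑' w : List L, {w | w ∈ Omega R B L α (c M) ∧ wordAct R w t = c M}.indicator
      (fun w => ‖wordWeight α w‖ₑ ^ 2) w ≤ {s | IsUnimodular B s}.indicator 1 t := by
  rw [ENNReal.tsum_eq_iSup_sum]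
  refine iSup_le fun s => le_trans ?_ (hit_le_indicator hB hR hT hc M (s.sup List.length) t)
  refine le_trans (Finset.sum_le_sum fun w hw => ?_) (ENNReal.sum_le_tsum s)
  refine Set.indicator_apply_le fun h => ?_
  rw [Set.indicator_of_mem]
  exact ⟨h.1, Finset.le_sup (f := List.length) hw, h.2⟩

/-- If `w ∈ Ω` but `l :: w ∉ Ω`, then `l :: w` leads from `c M` back to `c M`. Such words have total
squared weight at most 1 and all have frequency `c M`, so the empty word on the right pays for them.
-/
theorem tsum_cons_le (hB : B.Nonempty) (hR : 2 ≤ R)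
    (hT : (weightedMatrix R B L α).conjTranspose * weightedMatrix R B L α = 1)
    (hc : ∀ M, c M ∈ M.1) (M : {M : Set ℝ // IsMinSet R B L α M}) (ψ : ℝ → ℝ≥0∞) :
    ∑' l : L, ∑' w : List L, (Omega R B L α (c M)).indicator
        (fun w => ‖wordWeight α (l :: w)‖ₑ ^ 2 * ψ (wordFreq R (l :: w) (c M))) w ≤
      ∑' w : List L, (Omega R B L α (c M)).indicator
        (fun w => ‖wordWeight α w‖ₑ ^ 2 * ψ (wordFreq R w (c M))) w := by
  set Ω := Omega R B L α (c M) with hΩ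
  rw [tsum_list, Set.indicator_of_mem (nil_mem_Omega _), wordWeight_nil, wordFreq_nil]
  have hcycle : ∑' l : L, ∑' w : List L,
      ‖α l‖ₑ ^ 2 * ({w | w ∈ Ω ∧ wordAct R w (g R l (c M)) = c M}.indicator
        (fun w => ‖wordWeight α w‖ₑ ^ 2) w * ψ (c M)) ≤ ‖(1 : ℂ)‖ₑ ^ 2 * ψ (c M) := by
    simp only [ENNReal.tsum_mul_left, ENNReal.tsum_mul_right, ← mul_assoc]
    gcongr
    refine le_trans (ENNReal.tsum_le_tsum fun l : L => mul_le_mul_right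
      (tsum_Omega_le_indicator hB hR hT hc M (g R l (c M))) _) ?_
    refine le_trans (le_of_eq (Finset.tsum_subtype L fun l : ℤ =>
      ‖α l‖ₑ ^ 2 * {s | IsUnimodular B s}.indicator 1 (g R l (c M)))) ?_
    simpa using sum_enorm_sq_mul_indicator_le_one hB hT (c M)
  refine le_trans ?_ (add_le_add_left hcycle _)
  rw [← ENNReal.tsum_add]
  refine ENNReal.tsum_le_tsum fun l => ?_
  rw [← ENNReal.tsum_add]
  refine ENNReal.tsum_le_tsum fun w => ?_
  by_cases hw : w ∈ Ω
  · rw [Set.indicator_of_mem hw]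
    by_cases hlw : l :: w ∈ Ω
    · rw [Set.indicator_of_mem hlw]
      exact le_add_self
    · refine le_trans (le_of_eq ?_) le_self_add
      have hact := wordAct_cons_eq_of_notMem_Omega hw hlw
      rw [← (wordAct_eq_iff hR _ _ _).1 hact, Set.indicator_of_mem, wordWeight_cons, enorm_mul,
        mul_pow, mul_assoc]
      exact ⟨hw, hact⟩
  · rw [Set.indicator_of_notMem hw]
    exact zero_le

theorem tsum_hit_mul_eq (hR : 2 ≤ R) (M : {M : Set ℝ // IsMinSet R B L α M}) (n : ℕ)
    (ψ : ℝ → ℝ≥0∞) :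
    ∑' t : ℝ, hit R B L α (c M) n t * ψ t =
      ∑' w : List L, {w | w ∈ Omega R B L α (c M) ∧ w.length ≤ n}.indicator
        (fun w => ‖wordWeight α w‖ₑ ^ 2 * ψ (wordFreq R w (c M))) w := by
  simp only [hit, ← ENNReal.tsum_mul_right]
  rw [ENNReal.tsum_comm]
  refine tsum_congr fun w => ?_
  rw [tsum_eq_single (wordFreq R w (c M))]
  · by_cases hw : w ∈ Omega R B L α (c M) ∧ w.length ≤ n
    · rw [Set.indicator_of_mem, Set.indicator_of_mem]
      · exact hw
      · exact ⟨hw.1, hw.2, (wordAct_eq_iff hR _ _ _).2 rfl⟩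
    · rw [Set.indicator_of_notMem, Set.indicator_of_notMem, zero_mul]
      · exact hw
      · exact fun h => hw ⟨h.1, h.2.1⟩
  · intro t ht
    rw [Set.indicator_of_notMem, zero_mul]
    exact fun h => ht ((wordAct_eq_iff hR _ _ _).1 h.2.2)

/-- A finite part of the family has words of bounded length `n`, so a bound uniform in `n` on the
reaching sums controls the whole family. -/
theorem tsum_Omega_le_of_reach_le (hB : B.Nonempty) (hR : 2 ≤ R)
    (hT : (weightedMatrix R B L α).conjTranspose * weightedMatrix R B L α = 1)
    (hc : ∀ M, c M ∈ M.1) (ψ : ℝ → ℝ≥0∞) (a : ℝ≥0∞)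
    (h : ∀ n, ∑' t : ℝ, reach R L α (minSetUnion R B L α) n t * ψ t ≤ a) :
    ∑' p : (Σ M : {M : Set ℝ // IsMinSet R B L α M}, Omega R B L α (c M)),
      ‖wordWeight α p.2.1‖ₑ ^ 2 * ψ (wordFreq R p.2.1 (c p.1)) ≤ a := by
  rw [ENNReal.tsum_eq_iSup_sum]
  refine iSup_le fun s => le_trans ?_ (h (s.sup fun p => p.2.1.length))
  set n := s.sup fun p => p.2.1.length
  calc _ ≤ ∑' p : (Σ M : {M : Set ℝ // IsMinSet R B L α M}, Omega R B L α (c M)),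
        {w | w ∈ Omega R B L α (c p.1) ∧ w.length ≤ n}.indicator
        (fun w => ‖wordWeight α w‖ₑ ^ 2 * ψ (wordFreq R w (c p.1))) p.2.1 := by
        refine le_trans (Finset.sum_le_sum fun p hp => ?_) (ENNReal.sum_le_tsum s)
        rw [Set.indicator_of_mem]
        exact ⟨p.2.2, Finset.le_sup (f := fun p => p.2.1.length) hp⟩
    _ ≤ ∑' M, ∑' w : List L, {w | w ∈ Omega R B L α (c M) ∧ w.length ≤ n}.indicator
        (fun w => ‖wordWeight α w‖ₑ ^ 2 * ψ (wordFreq R w (c M))) w := by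
        rw [ENNReal.tsum_sigma']
        exact ENNReal.tsum_le_tsum fun M =>
          ENNReal.tsum_comp_le_tsum_of_injective Subtype.val_injective _
    _ = ∑' t : ℝ, (∑' M, hit R B L α (c M) n t) * ψ t := by
        simp only [← tsum_hit_mul_eq hR, ← ENNReal.tsum_mul_right]
        rw [ENNReal.tsum_comm]
    _ ≤ _ := by
        refine ENNReal.tsum_le_tsum fun t => ?_
        gcongr
        exact tsum_hit_le_reach hB hR hT hc n t

end Points

section SelfAffine

variable {μ : Measure ℝ}

/-! ### Integration against a self-affine measure -/

theorem measurable_tau (R : ℕ) (b : ℤ) : Measurable (tau R b) := by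
  unfold tau
  fun_prop

theorem IsSelfAffine.eq_smul_sum_map (h : IsSelfAffine R B μ) :
    μ = ((B.card : ENNReal)⁻¹) • ∑ b ∈ B, μ.map (tau R b) := by
  ext E hE
  rw [h E hE, Measure.smul_apply, Measure.finsetSum_apply, smul_eq_mul]
  congr 1
  exact Finset.sum_congr rfl fun b _ => (Measure.map_apply (measurable_tau R b) hE).symm

theorem IsSelfAffine.lintegral_eq (h : IsSelfAffine R B μ) {f : ℝ → ℝ≥0∞} (hf : Measurable f) :
    ∫⁻ x, f x ∂μ = (B.card : ENNReal)⁻¹ * ∑ b ∈ B, ∫⁻ x, f (tau R b x) ∂μ := by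
  conv_lhs => rw [h.eq_smul_sum_map]
  rw [lintegral_smul_measure, lintegral_finsetSum_measure, smul_eq_mul]
  congr 1
  exact Finset.sum_congr rfl fun b _ => lintegral_map hf (measurable_tau R b)

theorem IsSelfAffine.integrable_comp_tau (h : IsSelfAffine R B μ) {f : ℝ → ℂ}
    (hf : Measurable f) (hint : Integrable f μ) {b : ℤ} (hb : b ∈ B) :
    Integrable (fun x => f (tau R b x)) μ := by
  have hB : B.Nonempty := ⟨b, hb⟩
  rw [h.eq_smul_sum_map, integrable_smul_measure (by simp) (by simp [hB.ne_empty]),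
    integrable_finsetSum_measure] at hint
  exact (integrable_map_measure hf.aestronglyMeasurable (measurable_tau R b).aemeasurable).1
    (hint b hb)

theorem IsSelfAffine.integral_eq (h : IsSelfAffine R B μ) {f : ℝ → ℂ} (hf : Measurable f)
    (hint : Integrable f μ) :
    ∫ x, f x ∂μ = (B.card : ℂ)⁻¹ * ∑ b ∈ B, ∫ x, f (tau R b x) ∂μ := by
  conv_lhs => rw [h.eq_smul_sum_map]
  rw [integral_smul_measure, integral_finsetSum_measure]
  · simp only [ENNReal.toReal_inv, ENNReal.toReal_natCast, Complex.real_smul]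
    push_cast
    congr 1
    exact Finset.sum_congr rfl fun b _ =>
      integral_map (measurable_tau R b).aemeasurable hf.aestronglyMeasurable
  · intro b hb
    exact (integrable_map_measure hf.aestronglyMeasurable (measurable_tau R b).aemeasurable).2
      (h.integrable_comp_tau hf hint hb)

/-- The scalar product of `e_t` and `v` in `L²(μ)`. -/
noncomputable def expCoeff (μ : Measure ℝ) (v : ℝ → ℂ) (t : ℝ) : ℂ :=
  ∫ x, conj (expFun t x) * v x ∂μ

theorem measurable_expFun (t : ℝ) : Measurable (expFun t) := by
  unfold expFun
  fun_prop

@[simp]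
theorem norm_expFun (t x : ℝ) : ‖expFun t x‖ = 1 := by rw [expFun_eq_unitExp, norm_unitExp]

/-- The adjoint of the operator `v ↦ α_l e_l v(R ·)`, up to complex conjugation of the weight. -/
noncomputable def branch (R : ℕ) (B : Finset ℤ) (α : ℤ → ℂ) (l : ℤ) (v : ℝ → ℂ) (x : ℝ) : ℂ :=
  unitExp (-((R : ℝ)⁻¹ * l * x)) * (α l * digitAvg R B l fun b => v (tau R b x))

theorem measurable_branch (l : ℤ) {v : ℝ → ℂ} (hv : Measurable v) :
    Measurable (branch R B α l v) := by
  have h := continuous_unitExp.measurable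
  unfold branch digitAvg tau
  fun_prop

/-- The isometry relation is applied pointwise to the values `v (tau R b x)`, and the invariance of
`μ` reassembles the integral. -/
theorem IsSelfAffine.sum_lintegral_branch (h : IsSelfAffine R B μ) (hB : B.Nonempty)
    (hT : (weightedMatrix R B L α).conjTranspose * weightedMatrix R B L α = 1)
    {v : ℝ → ℂ} (hv : Measurable v) :
    ∑ l ∈ L, ∫⁻ x, ‖branch R B α l v x‖ₑ ^ 2 ∂μ = ∫⁻ x, ‖v x‖ₑ ^ 2 ∂μ := by
  have hm : ∀ l, Measurable fun x => ‖branch R B α l v x‖ₑ ^ 2 := fun l =>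
    (measurable_branch l hv).enorm.pow_const 2
  have hvm : ∀ b, Measurable fun x => ‖v (tau R b x)‖ₑ ^ 2 := fun b =>
    (hv.comp (measurable_tau R b)).enorm.pow_const 2
  have hN : (0 : ℝ) < B.card := by exact_mod_cast hB.card_pos
  rw [← lintegral_finsetSum _ fun l _ => hm l, h.lintegral_eq (hv.enorm.pow_const 2),
    ← lintegral_finsetSum _ fun b _ => hvm b,
    ← lintegral_const_mul _ (Finset.measurable_sum _ fun b _ => hvm b)]
  refine lintegral_congr fun x => ?_
  simp only [enorm_sq_eq_ofReal, branch, norm_mul (unitExp _), norm_unitExp, one_mul]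
  rw [← ENNReal.ofReal_sum_of_nonneg fun _ _ => by positivity,
    ← ENNReal.ofReal_sum_of_nonneg fun _ _ => by positivity, sum_norm_digitAvg_sq hB hT,
    ENNReal.ofReal_mul (by positivity), ENNReal.ofReal_inv_of_pos hN, ENNReal.ofReal_natCast]

/-- At a unimodular `s` the factors `unitExp (b * s)` all equal `mB B s` and leave the sum over the
digits. -/
theorem IsSelfAffine.expCoeff_branch [IsFiniteMeasure μ] (h : IsSelfAffine R B μ) (hR : 2 ≤ R)
    {v : ℝ → ℂ} (hv : Measurable v) (hint : Integrable v μ) {s : ℝ} (hs : IsUnimodular B s)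
    (l : ℤ) : expCoeff μ (branch R B α l v) s = α l * mB B s * expCoeff μ v (l + R * s) := by
  have hR0 := (natCast_pos_of_two_le hR).ne'
  have hmc : Measurable fun x => conj (expFun (l + R * s) x) :=
    Complex.continuous_conj.measurable.comp (measurable_expFun _)
  have hm : Measurable fun x => conj (expFun (l + R * s) x) * v x := hmc.mul hv
  have hi : Integrable (fun x => conj (expFun (l + R * s) x) * v x) μ :=
    hint.bdd_mul (c := 1) hmc.aestronglyMeasurable
      (Filter.Eventually.of_forall fun x => by simp)
  unfold expCoeff
  rw [h.integral_eq hm hi]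
  have key : ∀ x, conj (expFun s x) * branch R B α l v x = α l * mB B s * ((B.card : ℂ)⁻¹ *
      ∑ b ∈ B, conj (expFun (l + R * s) (tau R b x)) * v (tau R b x)) := by
    intro x
    have hb : ∀ b ∈ B, mB B s * (conj (expFun (l + R * s) (tau R b x)) * v (tau R b x)) =
        conj (expFun s x) * unitExp (-((R : ℝ)⁻¹ * l * x)) *
          (unitExp (-((R : ℝ)⁻¹ * l * b)) * v (tau R b x)) := by
      intro b hb
      rw [← hs b hb, expFun_eq_unitExp, expFun_eq_unitExp, conj_unitExp, conj_unitExp,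
        ← mul_assoc, ← mul_assoc, ← unitExp_add, ← unitExp_add, ← unitExp_add]
      congr 2
      unfold tau
      field_simp
      ring
    calc _ = α l * (B.card : ℂ)⁻¹ * ∑ b ∈ B, conj (expFun s x) *
          unitExp (-((R : ℝ)⁻¹ * l * x)) * (unitExp (-((R : ℝ)⁻¹ * l * b)) * v (tau R b x)) := by
          rw [branch, digitAvg, ← Finset.mul_sum]
          ring
      _ = _ := by
          rw [← Finset.sum_congr rfl hb, ← Finset.mul_sum]
          ring
  simp only [key]
  rw [integral_const_mul, integral_const_mul, integral_finsetSum]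
  exact fun b hb => h.integrable_comp_tau hm hi hb

theorem inner_expL2_toLp [IsFiniteMeasure μ] {v : ℝ → ℂ} (hv : MemLp v 2 μ) (t : ℝ) :
    inner ℂ (expL2 μ t) (hv.toLp v) = expCoeff μ v t := by
  rw [L2.inner_def, expCoeff]
  refine integral_congr_ae ?_
  filter_upwards [(memLp_expFun μ t).coeFn_toLp, hv.coeFn_toLp] with x h1 h2
  rw [expL2, h1, h2, RCLike.inner_apply, mul_comm]

/-- The Fourier transform of `μ`. -/
noncomputable def muHat (μ : Measure ℝ) (s : ℝ) : ℂ := ∫ x, expFun s x ∂μ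

theorem inner_expL2 [IsFiniteMeasure μ] (s t : ℝ) :
    inner ℂ (expL2 μ s) (expL2 μ t) = muHat μ (t - s) := by
  rw [expL2.eq_1 μ t, inner_expL2_toLp, expCoeff, muHat]
  congr 1 with x
  rw [expFun_eq_unitExp, expFun_eq_unitExp, expFun_eq_unitExp, conj_unitExp, ← unitExp_add]
  ring_nf

theorem muHat_zero [IsProbabilityMeasure μ] : muHat μ 0 = 1 := by
  simp [muHat, expFun_eq_unitExp]

theorem norm_expL2 [IsProbabilityMeasure μ] (t : ℝ) : ‖expL2 μ t‖ = 1 := by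
  have := inner_self_eq_norm_sq_to_K (𝕜 := ℂ) (expL2 μ t)
  rw [inner_expL2, sub_self, muHat_zero] at this
  have h2 : ‖expL2 μ t‖ ^ 2 = 1 := by
    apply Complex.ofReal_injective
    push_cast
    exact this.symm
  exact (pow_eq_one_iff_of_nonneg (norm_nonneg _) two_ne_zero).1 h2

theorem IsSelfAffine.muHat_eq [IsProbabilityMeasure μ] (h : IsSelfAffine R B μ) (s : ℝ) :
    muHat μ s = mB B ((R : ℝ)⁻¹ * s) * muHat μ ((R : ℝ)⁻¹ * s) := by
  have hi : Integrable (expFun s) μ := (memLp_expFun μ s).integrable one_le_two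
  unfold muHat
  rw [h.integral_eq (measurable_expFun s) hi, mB_eq_unitExp, mul_assoc, Finset.sum_mul]
  congr 1
  refine Finset.sum_congr rfl fun b _ => ?_
  rw [← integral_const_mul]
  congr 1 with x
  rw [expFun_eq_unitExp, expFun_eq_unitExp, ← unitExp_add, tau]
  ring_nf

/-! ### The Bessel inequality -/

theorem orthonormal_minSetUnion [IsProbabilityMeasure μ] (h : IsSelfAffine R B μ)
    (hB : B.Nonempty) (hR : 2 ≤ R)
    (hT : (weightedMatrix R B L α).conjTranspose * weightedMatrix R B L α = 1) :
    Orthonormal ℂ fun t : minSetUnion R B L α => expL2 μ t := by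
  refine ⟨fun t => norm_expL2 _, ?_⟩
  rintro ⟨s, M, hM, hs⟩ ⟨t, M', hM', ht⟩ hst
  rw [inner_expL2]
  exact (hM.isInvariant.union hM'.isInvariant).apply_sub_eq_zero hB hR hT (hM.1.union hM'.1)
    h.muHat_eq (Or.inl hs) (Or.inr ht) fun h => hst (Subtype.ext h)

theorem enorm_toLp_sq {v : ℝ → ℂ} (hv : MemLp v 2 μ) :
    ‖hv.toLp v‖ₑ ^ 2 = ∫⁻ x, ‖v x‖ₑ ^ 2 ∂μ := by
  rw [Lp.enorm_toLp, eLpNorm_eq_lintegral_rpow_enorm_toReal two_ne_zero ENNReal.ofNat_ne_top]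
  simp only [ENNReal.toReal_ofNat, ENNReal.rpow_ofNat]
  rw [← ENNReal.rpow_natCast, ← ENNReal.rpow_mul]
  simp

theorem memLp_two_of_lintegral_lt_top {v : ℝ → ℂ} (hv : Measurable v)
    (h : ∫⁻ x, ‖v x‖ₑ ^ 2 ∂μ < ∞) : MemLp v 2 μ := by
  refine ⟨hv.aestronglyMeasurable, ?_⟩
  rw [eLpNorm_lt_top_iff_lintegral_rpow_enorm_lt_top two_ne_zero ENNReal.ofNat_ne_top]
  simpa using h

/-- Induction on `n`, for all `v` at once: Bessel's inequality for the min-sets at `n = 0`, then the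
substitution `t = l + R s`, which turns coefficients of `v` into coefficients of its branches. -/
theorem tsum_reach_mul_le [IsProbabilityMeasure μ] (h : IsSelfAffine R B μ)
    (hB : B.Nonempty) (hR : 2 ≤ R)
    (hT : (weightedMatrix R B L α).conjTranspose * weightedMatrix R B L α = 1) (n : ℕ)
    {v : ℝ → ℂ} (hv : Measurable v) (hfin : ∫⁻ x, ‖v x‖ₑ ^ 2 ∂μ < ∞) :
    ∑' t : ℝ, reach R L α (minSetUnion R B L α) n t * ‖expCoeff μ v t‖ₑ ^ 2 ≤
      ∫⁻ x, ‖v x‖ₑ ^ 2 ∂μ := by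
  have hLp := memLp_two_of_lintegral_lt_top hv hfin
  induction n generalizing v with
  | zero =>
    have ho := orthonormal_minSetUnion h hB hR hT (L := L) (α := α)
    have h1 : ∀ t : ℝ, reach R L α (minSetUnion R B L α) 0 t * ‖expCoeff μ v t‖ₑ ^ 2 =
        (minSetUnion R B L α).indicator (fun t => ‖expCoeff μ v t‖ₑ ^ 2) t := fun t => by
      by_cases ht : t ∈ minSetUnion R B L α <;> simp [reach, ht]
    simp only [h1]
    rw [← tsum_subtype, ← enorm_toLp_sq hLp, enorm_sq_eq_ofReal, ENNReal.tsum_eq_iSup_sum]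
    refine iSup_le fun S => ?_
    refine le_trans (le_of_eq ?_) (ENNReal.ofReal_le_ofReal
      (ho.sum_inner_products_le (hLp.toLp v) (s := S)))
    rw [ENNReal.ofReal_sum_of_nonneg fun _ _ => by positivity]
    refine Finset.sum_congr rfl fun t _ => ?_
    rw [inner_expL2_toLp, enorm_sq_eq_ofReal]
  | succ n ih =>
    let e : ℤ → ℝ ≃ ℝ := fun l =>
      { toFun := fun s => l + R * s
        invFun := g R l
        left_inv := g_intCast_add_mul hR l
        right_inv := intCast_add_mul_g hR l }
    have hfin' : ∀ l ∈ L, ∫⁻ x, ‖branch R B α l v x‖ₑ ^ 2 ∂μ < ∞ := fun l hl =>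
      lt_of_le_of_lt (Finset.single_le_sum
        (f := fun l => ∫⁻ x, ‖branch R B α l v x‖ₑ ^ 2 ∂μ) (fun _ _ => zero_le) hl)
        (h.sum_lintegral_branch hB hT hv ▸ hfin)
    simp only [reach, Finset.sum_mul]
    rw [Summable.tsum_finsetSum fun _ _ => ENNReal.summable, ← h.sum_lintegral_branch hB hT hv]
    refine Finset.sum_le_sum fun l hl => ?_
    refine le_trans ?_ (ih (measurable_branch l hv) (hfin' l hl)
      (memLp_two_of_lintegral_lt_top (measurable_branch l hv) (hfin' l hl)))
    rw [← (e l).tsum_eq]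
    refine ENNReal.tsum_le_tsum fun s => ?_
    have he : e l s = l + R * s := rfl
    rw [he, g_intCast_add_mul hR]
    by_cases hs : IsUnimodular B s
    · rw [h.expCoeff_branch hR hv (hLp.integrable one_le_two) hs, enorm_mul, enorm_mul,
        ← ofReal_norm (mB B s), hs.norm_eq_one hB, ENNReal.ofReal_one, mul_one, mul_pow]
      exact le_of_eq (by ring)
    -- The intertwining relation is not needed at other points, since `reach` vanishes there.
    · have h0 := reach_le_indicator hB hR hT (L := L) (α := α)
        (fun _ => isUnimodular_of_mem_minSetUnion hB hR hT) n s
      rw [Set.indicator_of_notMem (by exact hs)] at h0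
      rw [le_antisymm h0 zero_le]
      simp

theorem tsum_enorm_inner_sq_le [IsProbabilityMeasure μ] (h : IsSelfAffine R B μ)
    (hB : B.Nonempty) (hR : 2 ≤ R)
    (hT : (weightedMatrix R B L α).conjTranspose * weightedMatrix R B L α = 1)
    {c : {M : Set ℝ // IsMinSet R B L α M} → ℝ} (hc : ∀ M, c M ∈ M.1) (v : Lp ℂ 2 μ) :
    ∑' p : (Σ M : {M : Set ℝ // IsMinSet R B L α M}, Omega R B L α (c M)),
      ‖wordWeight α p.2.1‖ₑ ^ 2 *
        ‖inner ℂ (expL2 μ (wordFreq R p.2.1 (c p.1))) v‖ₑ ^ 2 ≤ ‖v‖ₑ ^ 2 := by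
  have hv : Measurable v := (Lp.stronglyMeasurable v).measurable
  have hLp : MemLp v 2 μ := Lp.memLp v
  have hn : ‖v‖ₑ ^ 2 = ∫⁻ x, ‖v x‖ₑ ^ 2 ∂μ := by rw [← enorm_toLp_sq hLp, Lp.toLp_coeFn]
  have hi : ∀ t, inner ℂ (expL2 μ t) v = expCoeff μ v t := fun t => by
    rw [← inner_expL2_toLp hLp, Lp.toLp_coeFn]
  simp only [hi]
  rw [hn]
  exact tsum_Omega_le_of_reach_le hB hR hT hc (fun t => ‖expCoeff μ v t‖ₑ ^ 2) _ fun n =>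
    tsum_reach_mul_le h hB hR hT n hv (hn ▸ ENNReal.pow_lt_top enorm_lt_top)

/-! ### The sum of squares of the coefficients of an exponential -/

/-- The sum of `|⟨e_t, f⟩|²` over the members `f` of the weighted family of exponentials. -/
noncomputable def coeffSum (μ : Measure ℝ) (c : {M : Set ℝ // IsMinSet R B L α M} → ℝ) (t : ℝ) :
    ℝ≥0∞ :=
  ∑' p : (Σ M : {M : Set ℝ // IsMinSet R B L α M}, Omega R B L α (c M)),
    ‖wordWeight α p.2.1‖ₑ ^ 2 * ‖muHat μ (t - wordFreq R p.2.1 (c p.1))‖ₑ ^ 2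

theorem one_le_coeffSum [IsProbabilityMeasure μ] (c : {M : Set ℝ // IsMinSet R B L α M} → ℝ)
    (M : {M : Set ℝ // IsMinSet R B L α M}) : 1 ≤ coeffSum μ c (c M) := by
  refine le_trans (le_of_eq ?_) (ENNReal.le_tsum ⟨M, ⟨[], nil_mem_Omega _⟩⟩)
  simp [muHat_zero]

/-- By `muHat_eq`, prefixing `l` produces the factor `mB` at `g_l(t) - s` with `s` the old
frequency; as `s` is unimodular, its modulus is that of `mB` at `g_l(t)`. The left side is then the
sum over the words `l :: w` with `w ∈ Ω`. -/
theorem sum_mul_coeffSum_le [IsProbabilityMeasure μ] (h : IsSelfAffine R B μ)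
    (hB : B.Nonempty) (hR : 2 ≤ R)
    (hT : (weightedMatrix R B L α).conjTranspose * weightedMatrix R B L α = 1)
    {c : {M : Set ℝ // IsMinSet R B L α M} → ℝ} (hc : ∀ M, c M ∈ M.1) (t : ℝ) :
    ∑ l ∈ L, ‖α l * mB B (g R l t)‖ₑ ^ 2 * coeffSum μ c (g R l t) ≤ coeffSum μ c t := by
  have hsig : ∀ t, coeffSum μ c t = ∑' M, ∑' w : List L, (Omega R B L α (c M)).indicator
      (fun w => ‖wordWeight α w‖ₑ ^ 2 * ‖muHat μ (t - wordFreq R w (c M))‖ₑ ^ 2) w := fun t => by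
    rw [coeffSum, ENNReal.tsum_sigma']
    exact tsum_congr fun M => tsum_subtype (Omega R B L α (c M))
      fun w => ‖wordWeight α w‖ₑ ^ 2 * ‖muHat μ (t - wordFreq R w (c M))‖ₑ ^ 2
  rw [hsig t]
  refine le_trans (le_of_eq ?_) (ENNReal.tsum_le_tsum fun M =>
    tsum_cons_le hB hR hT hc M fun s => ‖muHat μ (t - s)‖ₑ ^ 2)
  rw [ENNReal.tsum_comm]
  refine (Finset.tsum_subtype L
    fun l => ‖α l * mB B (g R l t)‖ₑ ^ 2 * coeffSum μ c (g R l t)).symm.trans ?_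
  refine tsum_congr fun l => ?_
  rw [hsig, ← ENNReal.tsum_mul_left]
  refine tsum_congr fun M => ?_
  rw [← ENNReal.tsum_mul_left]
  refine tsum_congr fun w => ?_
  by_cases hw : w ∈ Omega R B L α (c M)
  · rw [Set.indicator_of_mem hw, Set.indicator_of_mem hw, wordFreq_cons, wordWeight_cons,
      h.muHat_eq (t - _)]
    have hu := (M.2.isUnimodular hB hR hT (hc M)).wordFreq hB (R := R) w
    have hR0 := (natCast_pos_of_two_le hR).ne'
    have harg : (R : ℝ)⁻¹ * (t - (((l : ℤ) : ℝ) + R * wordFreq R w (c M))) =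
        g R l t - wordFreq R w (c M) := by
      unfold g
      field_simp
      ring
    have hm : ‖mB B (g R l t - wordFreq R w (c M))‖ₑ = ‖mB B (g R l t)‖ₑ := by
      rw [← ofReal_norm, ← ofReal_norm, hu.norm_mB_sub hB]
    rw [harg]
    simp only [enorm_mul, mul_pow, hm]
    ring
  · rw [Set.indicator_of_notMem hw, Set.indicator_of_notMem hw, mul_zero]

end SelfAffine

open scoped ContDiff

/-! ### Analysis operators -/

section AnalysisOperator

variable {ι H : Type*} [NormedAddCommGroup H] [InnerProductSpace ℂ H]

theorem exists_analysisOperator (f : ι → H)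
    (hf : ∀ v, ∑' i, ‖inner ℂ (f i) v‖ₑ ^ 2 ≤ ‖v‖ₑ ^ 2) :
    ∃ T : H →L[ℂ] lp (fun _ : ι => ℂ) 2, (∀ v, ‖T v‖ ≤ ‖v‖) ∧
      ∀ v, HasSum (fun i => ‖inner ℂ (f i) v‖ ^ 2) (‖T v‖ ^ 2) := by
  have hfin : ∀ v (s : Finset ι), ∑ i ∈ s, ‖inner ℂ (f i) v‖ ^ 2 ≤ ‖v‖ ^ 2 := fun v s => by
    rw [← ENNReal.ofReal_le_ofReal_iff (by positivity), ← enorm_sq_eq_ofReal,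
      ENNReal.ofReal_sum_of_nonneg fun _ _ => by positivity]
    simp only [← enorm_sq_eq_ofReal]
    exact (ENNReal.sum_le_tsum s).trans (hf v)
  have hmem : ∀ v, Memℓp (fun i => inner ℂ (f i) v) 2 := fun v => by
    refine memℓp_gen' (C := ‖v‖ ^ 2) fun s => ?_
    simpa using hfin v s
  let T₀ : H →ₗ[ℂ] lp (fun _ : ι => ℂ) 2 :=
    { toFun := fun v => ⟨fun i => inner ℂ (f i) v, hmem v⟩
      map_add' := fun v w => by
        ext i
        exact inner_add_right _ _ _
      map_smul' := fun a v => by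
        ext i
        exact inner_smul_right _ _ _ }
  have hsum : ∀ v, HasSum (fun i => ‖inner ℂ (f i) v‖ ^ 2) (‖T₀ v‖ ^ 2) := fun v => by
    have : HasSum (fun i => ‖inner ℂ (f i) v‖ ^ (2 : ℝ≥0∞).toReal) (‖T₀ v‖ ^ (2 : ℝ≥0∞).toReal) :=
      lp.hasSum_norm (by simp) (T₀ v)
    simpa using this
  have hle : ∀ v, ‖T₀ v‖ ≤ ‖v‖ := fun v =>
    le_of_sq_le_sq ((hsum v).tsum_eq ▸ Real.tsum_le_of_sum_le (fun _ => by positivity) (hfin v))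
      (norm_nonneg _)
  exact ⟨T₀.mkContinuous 1 fun v => by simpa using hle v, hle, hsum⟩

/-- Since `‖A (T e)‖ ≤ ‖T e‖ = ‖e‖` and `⟨A (T e), e⟩ = ‖T e‖²`, expanding `‖A (T e) - e‖²` gives `A
(T e) = e` on `S`. Totality then yields `A T = 1`. -/
theorem norm_eq_of_dense_span {H' : Type*} [NormedAddCommGroup H'] [InnerProductSpace ℂ H']
    [CompleteSpace H] [CompleteSpace H'] (T : H →L[ℂ] H') (hT : ∀ v, ‖T v‖ ≤ ‖v‖) {S : Set H}
    (hS : ∀ e ∈ S, ‖T e‖ = ‖e‖) (hdense : ∀ v, (∀ e ∈ S, inner ℂ e v = 0) → v = 0) (v : H) :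
    ‖T v‖ = ‖v‖ := by
  set A := ContinuousLinearMap.adjoint T
  have hTn : ‖T‖ ≤ 1 := T.opNorm_le_bound zero_le_one fun v => by simpa using hT v
  have hA : ∀ w, ‖A w‖ ≤ ‖w‖ := fun w => by
    refine (A.le_opNorm w).trans (mul_le_of_le_one_left (norm_nonneg _) ?_)
    rwa [LinearIsometryEquiv.norm_map]
  have hfix : ∀ e ∈ S, A (T e) = e := fun e he => by
    have h1 : ‖A (T e) - e‖ ^ 2 = ‖A (T e)‖ ^ 2 - 2 * ‖T e‖ ^ 2 + ‖e‖ ^ 2 := by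
      rw [norm_sub_sq (𝕜 := ℂ), ContinuousLinearMap.adjoint_inner_left,
        inner_self_eq_norm_sq]
    have h2 := hA (T e)
    rw [hS e he] at h1 h2
    have h3 : ‖A (T e) - e‖ ^ 2 ≤ 0 := by
      nlinarith [norm_nonneg (A (T e)), norm_nonneg e]
    exact sub_eq_zero.1 (norm_eq_zero.1 (pow_eq_zero_iff two_ne_zero |>.1
      (le_antisymm h3 (by positivity))))
  have hAT : A (T v) = v := by
    rw [← sub_eq_zero]
    refine hdense _ fun e he => ?_
    rw [inner_sub_right, ContinuousLinearMap.adjoint_inner_right,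
      ← ContinuousLinearMap.adjoint_inner_left, hfix e he, sub_self]
  refine le_antisymm (hT v) ?_
  calc ‖v‖ = ‖A (T v)‖ := by rw [hAT]
    _ ≤ _ := hA _

end AnalysisOperator

/-! ### Totality of the exponentials -/

theorem charFun_withDensity_ofReal {μ : Measure ℝ} {u : ℝ → ℝ} (hu : Measurable u) (t : ℝ) :
    charFun (μ.withDensity fun x => ENNReal.ofReal (u x)) t =
      ∫ x, ((max (u x) 0 : ℝ) : ℂ) * Complex.exp (t * x * Complex.I) ∂μ := by
  rw [charFun_apply_real, integral_withDensity_eq_integral_toReal_smul hu.ennreal_ofReal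
    (Filter.Eventually.of_forall fun _ => ENNReal.ofReal_lt_top)]
  simp [ENNReal.toReal_ofReal']

/-- The positive and negative parts of `u` are densities of finite measures with the same
characteristic function, hence of the same measure. -/
theorem ae_eq_zero_of_forall_integral_exp_eq_zero {μ : Measure ℝ} [IsFiniteMeasure μ]
    {u : ℝ → ℝ} (hu : Measurable u) (hint : Integrable u μ)
    (h : ∀ t : ℝ, ∫ x, (u x : ℂ) * Complex.exp (t * x * Complex.I) ∂μ = 0) : u =ᵐ[μ] 0 := by
  have hneg : Measurable fun x => -u x := hu.neg
  have hexp : ∀ t : ℝ, Measurable fun x : ℝ => Complex.exp (t * x * Complex.I) := fun t => by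
    fun_prop
  have hmul : ∀ (w : ℝ → ℝ) (t : ℝ), Integrable w μ →
      Integrable (fun x => (w x : ℂ) * Complex.exp (t * x * Complex.I)) μ := fun w t hw =>
    hw.ofReal.mul_bdd (c := 1) (hexp t).aestronglyMeasurable
      (Filter.Eventually.of_forall fun x => by
        rw [← Complex.ofReal_mul, Complex.norm_exp_ofReal_mul_I])
  have hfin : ∀ w : ℝ → ℝ, Integrable w μ →
      IsFiniteMeasure (μ.withDensity fun x => ENNReal.ofReal (w x)) := fun w hw =>
    isFiniteMeasure_withDensity_ofReal hw.2
  have := hfin u hint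
  have := hfin (fun x => -u x) hint.neg
  have heq : (μ.withDensity fun x => ENNReal.ofReal (u x)) =
      μ.withDensity fun x => ENNReal.ofReal (-u x) := by
    refine Measure.ext_of_charFun (funext fun t => ?_)
    rw [charFun_withDensity_ofReal hu, charFun_withDensity_ofReal hneg, ← sub_eq_zero,
      ← integral_sub (hmul _ t hint.pos_part) (hmul _ t hint.neg_part), ← h t]
    congr 1 with x
    rw [← sub_mul, ← Complex.ofReal_sub]
    congr 2
    rcases le_total 0 (u x) with h0 | h0
    · rw [max_eq_left h0, max_eq_right (neg_nonpos.2 h0), sub_zero]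
    · rw [max_eq_right h0, max_eq_left (neg_nonneg.2 h0), zero_sub, neg_neg]
  have hae := (withDensity_eq_iff hu.ennreal_ofReal.aemeasurable
    hneg.ennreal_ofReal.aemeasurable hint.lintegral_lt_top.ne).1 heq
  filter_upwards [hae] with x hx
  rcases lt_trichotomy (u x) 0 with h0 | h0 | h0
  · rw [ENNReal.ofReal_of_nonpos h0.le] at hx
    exact absurd hx.symm (ENNReal.ofReal_pos.2 (neg_pos.2 h0)).ne'
  · exact h0
  · rw [ENNReal.ofReal_of_nonpos (neg_nonpos.2 h0.le)] at hx
    exact absurd hx (ENNReal.ofReal_pos.2 h0).ne'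

theorem eq_zero_of_forall_inner_expL2_eq_zero {μ : Measure ℝ} [IsFiniteMeasure μ]
    (v : Lp ℂ 2 μ) (h : ∀ t, inner ℂ (expL2 μ t) v = 0) : v = 0 := by
  have hv : Measurable v := (Lp.stronglyMeasurable v).measurable
  have hLp : MemLp v 2 μ := Lp.memLp v
  have hint : Integrable v μ := hLp.integrable one_le_two
  have hcoeff : ∀ t : ℝ, ∫ x, v x * Complex.exp (t * x * Complex.I) ∂μ = 0 := fun t => by
    rw [← h (-t / (2 * Real.pi)), ← Lp.toLp_coeFn v hLp, inner_expL2_toLp, expCoeff]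
    refine integral_congr_ae ?_
    filter_upwards [hLp.coeFn_toLp] with x hx
    rw [expFun_eq_unitExp, conj_unitExp, mul_comm, unitExp, hx]
    congr 2
    push_cast
    have : (Real.pi : ℂ) ≠ 0 := by exact_mod_cast Real.pi_ne_zero
    field_simp
  have hexpint : ∀ (w : ℝ → ℂ) (t : ℝ), Integrable w μ →
      Integrable (fun x => w x * Complex.exp (t * x * Complex.I)) μ := fun w t hw =>
    hw.mul_bdd (c := 1) (by fun_prop : Measurable fun x : ℝ =>
        Complex.exp (t * x * Complex.I)).aestronglyMeasurable
      (Filter.Eventually.of_forall fun x => by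
        rw [← Complex.ofReal_mul, Complex.norm_exp_ofReal_mul_I])
  have hcoeff' : ∀ t : ℝ, ∫ x, conj (v x) * Complex.exp (t * x * Complex.I) ∂μ = 0 := fun t => by
    rw [← map_zero (starRingEnd ℂ), ← hcoeff (-t), ← integral_conj]
    congr 1 with x
    rw [map_mul, ← Complex.exp_conj]
    simp
  have hint' : Integrable (fun x => conj (v x)) μ :=
    Complex.conjLIE.toContinuousLinearEquiv.toContinuousLinearMap.integrable_comp hint
  have hre : (fun x => (v x).re) =ᵐ[μ] 0 := by
    refine ae_eq_zero_of_forall_integral_exp_eq_zero hv.re hint.re fun t => ?_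
    have : ∀ x, (((v x).re : ℝ) : ℂ) * Complex.exp (t * x * Complex.I) = 2⁻¹ *
        (v x * Complex.exp (t * x * Complex.I) + conj (v x) * Complex.exp (t * x * Complex.I)) :=
      fun x => by
        rw [Complex.re_eq_add_conj]
        ring
    simp only [this]
    rw [integral_const_mul, integral_add (hexpint _ t hint) (hexpint _ t hint'), hcoeff, hcoeff']
    simp
  have him : (fun x => (v x).im) =ᵐ[μ] 0 := by
    refine ae_eq_zero_of_forall_integral_exp_eq_zero hv.im hint.im fun t => ?_
    have : ∀ x, (((v x).im : ℝ) : ℂ) * Complex.exp (t * x * Complex.I) = (2 * Complex.I)⁻¹ *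
        (v x * Complex.exp (t * x * Complex.I) - conj (v x) * Complex.exp (t * x * Complex.I)) :=
      fun x => by
        rw [Complex.im_eq_sub_conj]
        ring
    simp only [this]
    rw [integral_const_mul, integral_sub (hexpint _ t hint) (hexpint _ t hint'), hcoeff, hcoeff']
    simp
  rw [Lp.eq_zero_iff_ae_eq_zero]
  filter_upwards [hre, him] with x h1 h2
  exact Complex.ext h1 h2

/-! ### Analyticity of the exponentials -/

theorem exists_ae_abs_le {R : ℕ} (hR : 2 ≤ R) (B : Finset ℤ) (hB : B.Nonempty) :
    ∃ K : ℝ, ∀ᵐ x ∂(selfAffineMeasure R B hB), |x| ≤ K := by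
  obtain ⟨K, hK⟩ := exists_abs_digit_le B
  have hs : Summable fun k : ℕ => ((R : ℝ)⁻¹) ^ (k + 1) * K :=
    ((summable_nat_add_iff 1).2
      (summable_geometric_of_lt_one (by positivity) (inv_natCast_lt_one hR))).mul_right K
  refine ⟨∑' k : ℕ, ((R : ℝ)⁻¹) ^ (k + 1) * K, ?_⟩
  rw [selfAffineMeasure, ae_map_iff (measurable_codingMap R B).aemeasurable
    (measurableSet_le continuous_abs.measurable measurable_const)]
  refine Filter.Eventually.of_forall fun d => ?_
  rw [← Real.norm_eq_abs, codingMap]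
  refine tsum_of_norm_bounded hs.hasSum fun k => ?_
  rw [norm_mul, Real.norm_of_nonneg (by positivity), Real.norm_eq_abs]
  exact mul_le_mul_of_nonneg_left (hK _) (by positivity)

/-- Boundedness of the support allows complex frequencies; the resulting `L²`-valued function is
entire, and its restriction to the real line is analytic. -/
theorem contDiff_expL2 {μ : Measure ℝ} [IsProbabilityMeasure μ] {K : ℝ}
    (hK : ∀ᵐ x ∂μ, |x| ≤ K) : ContDiff ℝ ω (expL2 μ) := by
  set a : ℝ → ℂ := fun x => 2 * Real.pi * Complex.I * x with ha
  have ham : Measurable a := by fun_prop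
  obtain ⟨K', hK'0, hK'⟩ : ∃ K' : ℝ, 0 ≤ K' ∧ ∀ᵐ x ∂μ, ‖a x‖ ≤ K' := by
    refine ⟨2 * Real.pi * |K|, by positivity, ?_⟩
    filter_upwards [hK] with x hx
    simp only [ha, norm_mul, Complex.norm_I, Complex.norm_real, Real.norm_eq_abs,
      Complex.norm_ofNat, abs_of_pos Real.pi_pos, mul_one]
    exact mul_le_mul_of_nonneg_left (hx.trans (le_abs_self K)) (by positivity)
  have hexp : ∀ z : ℂ, ∀ᵐ x ∂μ, ‖Complex.exp (z * a x)‖ ≤ Real.exp (‖z‖ * K') := fun z => by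
    filter_upwards [hK'] with x hx
    refine (Complex.norm_exp_le_exp_norm _).trans (Real.exp_le_exp.2 ?_)
    rw [norm_mul]
    gcongr
  have hE : ∀ z : ℂ, MemLp (fun x => Complex.exp (z * a x)) 2 μ := fun z =>
    MemLp.of_bound (by fun_prop) _ (hexp z)
  have hD : ∀ z : ℂ, MemLp (fun x => a x * Complex.exp (z * a x)) 2 μ := fun z =>
    MemLp.of_bound (C := K' * Real.exp (‖z‖ * K')) (by fun_prop) (by
      filter_upwards [hexp z, hK'] with x hx hx'
      rw [norm_mul]
      gcongr)
  have hderiv : ∀ z, HasDerivAt (fun z => (hE z).toLp _) ((hD z).toLp _) z := by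
    intro z
    rw [hasDerivAt_iff_isLittleO_nhds_zero]
    refine Asymptotics.IsBigO.trans_isLittleO (g := fun h : ℂ => h ^ 2) ?_
      (Asymptotics.isLittleO_pow_id one_lt_two)
    -- Here `exp (‖z‖ K')` bounds `e^{z a}`, and `K'² ‖h‖²` bounds the Taylor remainder `e^{h a} - 1
    -- - h a` when `‖h a‖ ≤ 1`.
    refine Asymptotics.IsBigO.of_bound (Real.exp (‖z‖ * K') * K' ^ 2) ?_
    have hsmall : ∀ᶠ h : ℂ in nhds 0, ‖h‖ * K' < 1 := by
      have : Filter.Tendsto (fun h : ℂ => ‖h‖ * K') (nhds 0) (nhds 0) := by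
        have := (continuous_norm.mul continuous_const).tendsto (0 : ℂ) (f := fun h : ℂ => ‖h‖ * K')
        simpa using this
      exact this.eventually_lt_const one_pos
    filter_upwards [hsmall] with h hh
    rw [← MemLp.toLp_sub, ← MemLp.toLp_const_smul, ← MemLp.toLp_sub]
    have hbound := Lp.norm_le_of_ae_bound (μ := μ) (p := 2)
      (f := ((((hE (z + h)).sub (hE z)).sub ((hD z).const_smul h)).toLp _))
      (C := Real.exp (‖z‖ * K') * K' ^ 2 * ‖h ^ 2‖) (by positivity) ?_
    · simpa [measureUnivNNReal] using hbound
    · filter_upwards [(((hE (z + h)).sub (hE z)).sub ((hD z).const_smul h)).coeFn_toLp, hexp z,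
        hK'] with x hx hx1 hx2
      rw [hx]
      have h1 : ‖h * a x‖ ≤ ‖h‖ * K' := by
        rw [norm_mul]
        gcongr
      have h2 := Complex.norm_exp_sub_one_sub_id_le (h1.trans hh.le)
      have h3 : (((fun x => Complex.exp ((z + h) * a x)) - fun x => Complex.exp (z * a x)) -
          h • fun x => a x * Complex.exp (z * a x)) x =
          Complex.exp (z * a x) * (Complex.exp (h * a x) - 1 - h * a x) := by
        simp only [Pi.sub_apply, Pi.smul_apply, smul_eq_mul]
        rw [add_mul, Complex.exp_add]
        ring
      rw [h3, norm_mul, mul_assoc]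
      gcongr
      refine h2.trans ?_
      rw [norm_pow, ← mul_pow, mul_comm K']
      gcongr
  have hdiff : Differentiable ℂ fun z => (hE z).toLp _ := fun z => (hderiv z).differentiableAt
  have hcd : ContDiff ℝ ω fun z => (hE z).toLp _ := (hdiff.contDiff).restrict_scalars ℝ
  have heq : expL2 μ = (fun z => (hE z).toLp _) ∘ Complex.ofRealCLM := by
    ext1 t
    simp only [Function.comp, expL2]
    congr 1 with x
    simp only [expFun, ha, Complex.ofRealCLM_apply]
    ring_nf
  rw [heq]
  exact hcd.comp Complex.ofRealCLM.contDiff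

/-! ### Superharmonic functions -/

/-- Minimum principle: superharmonicity at a minimizer forces every possible target to be a
minimizer too. -/
theorem one_le_of_sum_le (hB : B.Nonempty) (hR : 2 ≤ R)
    (hT : (weightedMatrix R B L α).conjTranspose * weightedMatrix R B L α = 1)
    {F : ℝ → ℝ} (hF : AnalyticOnNhd ℝ F Set.univ)
    (hsuper : ∀ t, ∑ l ∈ L, ‖α l * mB B (g R l t)‖ ^ 2 * F (g R l t) ≤ F t)
    (hmin : ∀ M, IsMinSet R B L α M → ∃ t ∈ M, 1 ≤ F t) (h0 : 1 ≤ F 0) (t : ℝ) : 1 ≤ F t := by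
  obtain ⟨K, hK⟩ := exists_abs_digit_le L
  -- As `ρ` dominates all digits, `|s - l| ≤ 2ρ ≤ Rρ`: the interval `[-ρ, ρ]` contains `t` and is
  -- mapped into itself by every `g_l`.
  set ρ := |t| + |K|
  have hR2 : (2 : ℝ) ≤ R := by exact_mod_cast hR
  have hmaps : ∀ l ∈ L, ∀ s, |s| ≤ ρ → |g R l s| ≤ ρ := fun l hl s hs => by
    have h1 : |s - l| ≤ 2 * ρ := by
      have h2 := hK ⟨l, hl⟩
      have h3 := abs_sub s l
      have h4 := le_abs_self K
      have h5 := abs_nonneg t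
      simp only at h2
      simp only [ρ] at hs ⊢
      linarith
    rw [g, abs_mul, abs_of_pos (inv_pos.2 (natCast_pos_of_two_le hR)),
      inv_mul_le_iff₀ (natCast_pos_of_two_le hR)]
    have : 0 ≤ ρ := by positivity
    nlinarith
  have hcont : Continuous F := continuousOn_univ.1 hF.continuousOn
  have hmem : ∀ s, s ∈ Set.Icc (-ρ) ρ ↔ |s| ≤ ρ := fun s => abs_le.symm
  have ht : t ∈ Set.Icc (-ρ) ρ := (hmem t).2 (le_add_of_nonneg_right (abs_nonneg K))
  obtain ⟨s₀, hs₀, hs₀min⟩ := isCompact_Icc.exists_isMinOn ⟨t, ht⟩ hcont.continuousOn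
  suffices hm : 1 ≤ F s₀ from hm.trans (hs₀min ht)
  set Z := {s ∈ Set.Icc (-ρ) ρ | F s = F s₀}
  have hZ : IsInvariant R B L α Z := by
    rintro s ⟨hsI, hsF⟩ l hl hp
    have hle : ∀ k ∈ L, F s₀ ≤ F (g R k s) := fun k hk =>
      hs₀min ((hmem _).2 (hmaps k hk s ((hmem s).1 hsI)))
    have hnn : ∀ k ∈ L, 0 ≤ ‖α k * mB B (g R k s)‖ ^ 2 * (F (g R k s) - F s₀) := fun k hk =>
      mul_nonneg (by positivity) (sub_nonneg.2 (hle k hk))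
    have hsum : ∑ k ∈ L, ‖α k * mB B (g R k s)‖ ^ 2 * (F (g R k s) - F s₀) = 0 := by
      refine le_antisymm ?_ (Finset.sum_nonneg hnn)
      simp only [mul_sub]
      rw [Finset.sum_sub_distrib, ← Finset.sum_mul, sum_norm_mB_sq hB hT, one_mul, ← hsF]
      exact sub_nonpos.2 (hsuper s)
    have h1 := (Finset.sum_eq_zero_iff_of_nonneg hnn).1 hsum l hl
    refine ⟨(hmem _).2 (hmaps l hl s ((hmem s).1 hsI)), sub_eq_zero.1 ?_⟩
    exact (mul_eq_zero.1 h1).resolve_left (pow_ne_zero 2 (norm_ne_zero_iff.2 hp))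
  by_cases hfin : Z.Finite
  · obtain ⟨M, hMZ, hM⟩ := exists_isMinSet_subset hfin ⟨s₀, hs₀, rfl⟩ hZ
    obtain ⟨x, hx, hFx⟩ := hmin M hM
    rwa [← (hMZ hx).2]
  -- Infinitely many minimizers accumulate in the interval, so `F` is constant by the identity
  -- theorem.
  · obtain ⟨x, -, hx⟩ := Set.Infinite.exists_accPt_of_subset_isCompact hfin isCompact_Icc
      (fun s hs => hs.1)
    have hfreq : ∃ᶠ s in nhdsWithin x {x}ᶜ, F s = F s₀ :=
      (accPt_iff_frequently_nhdsNE.1 hx).mono fun s hs => hs.2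
    have := hF.eqOn_of_preconnected_of_frequently_eq analyticOnNhd_const
      isPreconnected_univ (Set.mem_univ x) hfreq (Set.mem_univ 0)
    exact h0.trans_eq this

/-! ### The Parseval identity -/

/-- The weighted exponentials indexed by the min-sets and the words of `Ω` form a Parseval
frame. -/
theorem isParsevalFrame_weightedExp (hR : 2 ≤ R) (hB : B.Nonempty) (h0L : (0 : ℤ) ∈ L)
    (hα0 : α 0 = 1)
    (hT : (weightedMatrix R B L α).conjTranspose * weightedMatrix R B L α = 1)
    (c : {M : Set ℝ // IsMinSet R B L α M} → ℝ) (hc : ∀ M, c M ∈ M.1) :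
    IsParsevalFrame (fun p : (Σ M : {M : Set ℝ // IsMinSet R B L α M}, Omega R B L α (c M)) =>
      wordWeight α p.2.1 •
        expL2 (selfAffineMeasure R B hB) (wordFreq R p.2.1 (c p.1))) := by
  set μ := selfAffineMeasure R B hB
  have hμ : IsSelfAffine R B μ := isSelfAffine_selfAffineMeasure hR B hB
  set f := fun p : (Σ M : {M : Set ℝ // IsMinSet R B L α M}, Omega R B L α (c M)) =>
    wordWeight α p.2.1 • expL2 μ (wordFreq R p.2.1 (c p.1))
  have hfv : ∀ p v, ‖inner ℂ (f p) v‖ₑ ^ 2 = ‖wordWeight α p.2.1‖ₑ ^ 2 *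
      ‖inner ℂ (expL2 μ (wordFreq R p.2.1 (c p.1))) v‖ₑ ^ 2 := fun p v => by
    rw [inner_smul_left, enorm_mul, mul_pow, ← ofReal_norm (starRingEnd ℂ _), Complex.norm_conj,
      ofReal_norm]
  obtain ⟨T, hTle, hTsum⟩ := exists_analysisOperator f fun v => by
    simp only [hfv]
    exact tsum_enorm_inner_sq_le hμ hB hR hT hc v
  have hcoeff : ∀ t, ENNReal.ofReal (‖T (expL2 μ t)‖ ^ 2) = coeffSum μ c t := fun t => by
    rw [← (hTsum _).tsum_eq, ENNReal.ofReal_tsum_of_nonneg (fun _ => by positivity)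
      (hTsum _).summable]
    simp only [← enorm_sq_eq_ofReal, hfv, inner_expL2, coeffSum]
  have hone : ∀ M, 1 ≤ ‖T (expL2 μ (c M))‖ ^ 2 := fun M => by
    rw [← ENNReal.one_le_ofReal, hcoeff]
    exact one_le_coeffSum c M
  obtain ⟨K, hK⟩ := exists_ae_abs_le hR B hB
  have hF : AnalyticOnNhd ℝ (fun t => ‖T (expL2 μ t)‖ ^ 2) Set.univ := by
    rw [← contDiff_omega_iff_analyticOnNhd]
    have h1 : ContDiff ℝ ω fun t => T (expL2 μ t) :=
      (T.restrictScalars ℝ).contDiff.comp (contDiff_expL2 hK)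
    exact h1.norm_sq ℂ
  have hsuper : ∀ t, ∑ l ∈ L, ‖α l * mB B (g R l t)‖ ^ 2 * ‖T (expL2 μ (g R l t))‖ ^ 2 ≤
      ‖T (expL2 μ t)‖ ^ 2 := fun t => by
    rw [← ENNReal.ofReal_le_ofReal_iff (by positivity), hcoeff,
      ENNReal.ofReal_sum_of_nonneg fun _ _ => by positivity]
    refine le_trans (le_of_eq ?_) (sum_mul_coeffSum_le hμ hB hR hT hc t)
    refine Finset.sum_congr rfl fun l _ => ?_
    rw [ENNReal.ofReal_mul (by positivity), hcoeff, enorm_sq_eq_ofReal]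
  have h0 : 1 ≤ ‖T (expL2 μ 0)‖ ^ 2 := by
    have h := hc ⟨{0}, isMinSet_singleton_zero hB hT h0L hα0⟩
    have h' := hone ⟨{0}, isMinSet_singleton_zero hB hT h0L hα0⟩
    rwa [Set.mem_singleton_iff.1 h] at h'
  have hexp : ∀ t, ‖T (expL2 μ t)‖ = ‖expL2 μ t‖ := fun t => by
    refine le_antisymm (hTle _) ?_
    rw [norm_expL2]
    have := one_le_of_sum_le hB hR hT hF hsuper (fun M hM => ⟨_, hc ⟨M, hM⟩, hone ⟨M, hM⟩⟩) h0 t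
    exact (one_le_sq_iff₀ (norm_nonneg _)).1 this
  intro v
  have hnorm := norm_eq_of_dense_span T hTle (S := Set.range (expL2 μ))
    (by rintro _ ⟨t, rfl⟩; exact hexp t)
    (fun v hv => eq_zero_of_forall_inner_expL2_eq_zero v fun t => hv _ ⟨t, rfl⟩) v
  simpa only [hnorm, norm_inner_symm] using hTsum v

end WeightedFourier

theorem mainTheorem1 (R : ℕ) (hR : 2 ≤ R) (B : Finset ℤ) (hB : B.Nonempty)
    (L : Finset ℤ) (h0L : (0 : ℤ) ∈ L) (α : ℤ → ℂ) (hα0 : α 0 = 1)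
    (hT : (WeightedFourier.weightedMatrix R B L α).conjTranspose *
      WeightedFourier.weightedMatrix R B L α = 1)
    (c : {M : Set ℝ // WeightedFourier.IsMinSet R B L α M} → ℝ)
    (hc : ∀ M, c M ∈ M.1) :
    WeightedFourier.IsParsevalFrame
      (fun p : (Σ M : {M : Set ℝ // WeightedFourier.IsMinSet R B L α M},
          WeightedFourier.Omega R B L α (c M)) =>
        WeightedFourier.wordWeight α p.2.1 •
          WeightedFourier.expL2 (WeightedFourier.selfAffineMeasure R B hB)
            (WeightedFourier.wordFreq R p.2.1 (c p.1))) :=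
  WeightedFourier.isParsevalFrame_weightedExp hR hB h0L hα0 hT c hc
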